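/- Let $\Bbbk$ be an algebraically closed field of characteristic $0$, let $V$ be a finite-dimensional $\Bbbk$-vector space with dual $V^\vee$, let $S=\operatorname{Sym}(V)$, and let $K\subseteq\bigwedge^2V$ be a linear subspace. The Koszul module $W(V,K)$ is the graded $S$-module given by the middle homology of $$K\otimes S\xrightarrow{\ \delta_2\ }V\otimes S(1)\xrightarrow{\ \delta_1\ }S(2),\qquad \delta_2(v_1\wedge v_2\otimes f)=v_2\otimes v_1f-v_1\otimes v_2f,\quad \delta_1(v\otimes f)=vf,$$ so that its degree $q$ piece $W_q(V,K)$ is the homology of $K\otimes\operatorname{Sym}^qV\to V\otimes\operatorname{Sym}^{q+1}V\to\operatorname{Sym}^{q+2}V$. Let $K^\perp\subseteq\bigwedge^2V^\vee$ be the subspace of functionals vanishing on $K$, and let $$\mathcal R(V,K)=\{a\in V^\vee:\ \exists\, b\in V^\vee,\ a\wedge b\in K^\perp\setminus\{0\}\}\cup\{0\}$$ be the resonance variety. A linear subspace $U\subseteq V^\vee$ is called strongly isotropic (with respect to $K$) if it is isotropic, i.e. $\bigwedge^2U\subseteq K^\perp$, and separable, i.e. $K^\perp\cap\langle U\rangle\subseteq\bigwedge^2U$,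 where $\langle U\rangle$ is the ideal of the exterior algebra $\bigwedge V^\vee$ generated by $U$. The module $W(V,K)$ is called strongly isotropic if every irreducible component of $\mathcal R(V,K)$ (for the Zariski topology) is a linear subspace of $V^\vee$ and is strongly isotropic. Suppose that $W(V,K)$ is strongly isotropic, and write $\mathcal R(V,K)=\overline V_1^\vee\cup\cdots\cup\overline V_k^\vee$, where $\overline V_1^\vee,\dots,\overline V_k^\vee\subseteq V^\vee$ are the distinct irreducible components of $\mathcal R(V,K)$, and $\overline V_t$ is the dual space of $\overline V_t^\vee$. Then there is $q_0$ such that for all integers $q\ge q_0$ $$\dim_{\Bbbk} W_q(V,K)=\sum_{t=1}^k(q+1)\binom{q+\dim\overline V_t}{q+2}.$$ -/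

import Mathlib

open scoped TensorProduct

namespace KoszulResonance

universe u v

noncomputable section

variable {𝕜 : Type u} [Field 𝕜] {V : Type v} [AddCommGroup V] [Module 𝕜 V]

/-! ### Koszul modules -/

/-- The symmetric algebra `S = Sym V`. -/
def Sym (𝕜 : Type u) [Field 𝕜] (V : Type v) [AddCommGroup V] [Module 𝕜 V] : Type (max u v) :=
  SymmetricAlgebra 𝕜 V

instance : CommRing (Sym 𝕜 V) := inferInstanceAs (CommRing (SymmetricAlgebra 𝕜 V))

instance : Algebra 𝕜 (Sym 𝕜 V) := inferInstanceAs (Algebra 𝕜 (SymmetricAlgebra 𝕜 V))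

/-- The canonical inclusion `V → Sym V`. -/
def symι (𝕜 : Type u) [Field 𝕜] (V : Type v) [AddCommGroup V] [Module 𝕜 V] : V →ₗ[𝕜] Sym 𝕜 V :=
  SymmetricAlgebra.ι 𝕜 V

/-- Elements of `Sym V` are polynomial functions on `V^∨`: the value at `a : V^∨` is given by the
algebra map `Sym V → 𝕜` that extends `a`. -/
def symEval (a : Module.Dual 𝕜 V) : Sym 𝕜 V →ₐ[𝕜] 𝕜 :=
  SymmetricAlgebra.lift a

theorem symEval_symι (a : Module.Dual 𝕜 V) (v : V) : symEval a (symι 𝕜 V v) = a v :=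
  SymmetricAlgebra.lift_ι_apply a v

/-- The degree `q` piece `Sym^q V` of the symmetric algebra `S = Sym V`: the span of all products
of `q` elements of `V`. -/
def symPow (𝕜 : Type u) [Field 𝕜] (V : Type v) [AddCommGroup V] [Module 𝕜 V] (q : ℕ) :
    Submodule 𝕜 (Sym 𝕜 V) :=
  LinearMap.range (symι 𝕜 V) ^ q

/-- The Koszul differential `δ₁ : V ⊗ S → S`, `v ⊗ f ↦ v f`. The factor `S` is written on the
left, so that the `S`-module structure is the one on the left factor. -/
def delta₁ (𝕜 : Type u) [Field 𝕜] (V : Type v) [AddCommGroup V] [Module 𝕜 V] :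
    Sym 𝕜 V ⊗[𝕜] V →ₗ[Sym 𝕜 V] Sym 𝕜 V :=
  (symι 𝕜 V).liftBaseChange (Sym 𝕜 V)

/-- The alternating map `(v₁, v₂) ↦ v₂ ⊗ v₁ - v₁ ⊗ v₂` (with the symmetric algebra factor on the
left: `v₁ ⊗ v₂ - v₂ ⊗ v₁`). -/
def delta₂Alt (𝕜 : Type u) [Field 𝕜] (V : Type v) [AddCommGroup V] [Module 𝕜 V] :
    V [⋀^Fin 2]→ₗ[𝕜] Sym 𝕜 V ⊗[𝕜] V where
  toFun v := symι 𝕜 V (v 0) ⊗ₜ[𝕜] v 1 - symι 𝕜 V (v 1) ⊗ₜ[𝕜] v 0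
  map_update_add' m i x y := by
    fin_cases i <;> simp [TensorProduct.add_tmul, TensorProduct.tmul_add] <;> abel
  map_update_smul' m i c x := by
    fin_cases i <;> simp [TensorProduct.smul_tmul', smul_sub]
  map_eq_zero_of_eq' v i j h hij := by
    fin_cases i <;> fin_cases j <;> simp_all

/-- The Koszul differential `δ₂ : ⋀² V ⊗ S → V ⊗ S`,
`(v₁ ∧ v₂) ⊗ f ↦ v₂ ⊗ v₁ f - v₁ ⊗ v₂ f`. -/
def delta₂ (𝕜 : Type u) [Field 𝕜] (V : Type v) [AddCommGroup V] [Module 𝕜 V] :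
    Sym 𝕜 V ⊗[𝕜] (⋀[𝕜]^2 V) →ₗ[Sym 𝕜 V]
      Sym 𝕜 V ⊗[𝕜] V :=
  (exteriorPower.alternatingMapLinearEquiv (delta₂Alt 𝕜 V)).liftBaseChange (Sym 𝕜 V)

theorem delta₂_tmul (f : Sym 𝕜 V) (v₁ v₂ : V) :
    delta₂ 𝕜 V (f ⊗ₜ exteriorPower.ιMulti 𝕜 2 ![v₁, v₂]) =
      (symι 𝕜 V v₁ * f) ⊗ₜ[𝕜] v₂ - (symι 𝕜 V v₂ * f) ⊗ₜ[𝕜] v₁ := by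
  simp [delta₂, delta₂Alt, smul_sub, TensorProduct.smul_tmul', mul_comm]

/-- The restriction of `δ₂` to `K ⊗ S`, for a subspace `K ⊆ ⋀² V`. -/
def delta₂On (K : Submodule 𝕜 (⋀[𝕜]^2 V)) :
    Sym 𝕜 V ⊗[𝕜] K →ₗ[Sym 𝕜 V] Sym 𝕜 V ⊗[𝕜] V :=
  delta₂ 𝕜 V ∘ₗ K.subtype.baseChange (Sym 𝕜 V)

/-- `K ⊗ S → V ⊗ S → S` is a complex. -/
theorem delta₁_comp_delta₂ : delta₁ 𝕜 V ∘ₗ delta₂ 𝕜 V = 0 := by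
  have h : ((delta₁ 𝕜 V).restrictScalars 𝕜) ∘ₗ
      exteriorPower.alternatingMapLinearEquiv (delta₂Alt 𝕜 V) = 0 := by
    apply exteriorPower.linearMap_ext
    ext v
    simp [delta₁, delta₂Alt, mul_comm]
  refine TensorProduct.AlgebraTensorModule.curry_injective (LinearMap.ext_ring (LinearMap.ext ?_))
  intro x
  simpa [delta₂] using DFunLike.congr_fun h x

/-- The Koszul module `W(V, K)`: the middle homology `ker δ₁ / im δ₂|_{K ⊗ S}` of
`K ⊗ S → V ⊗ S → S`, realised as the image of the cycles `ker δ₁` in the quotient of `V ⊗ S` by the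
boundaries `im δ₂|_{K ⊗ S}`. -/
def koszulModule (K : Submodule 𝕜 (⋀[𝕜]^2 V)) :
    Submodule (Sym 𝕜 V) ((Sym 𝕜 V ⊗[𝕜] V) ⧸ LinearMap.range (delta₂On K)) :=
  (LinearMap.ker (delta₁ 𝕜 V)).map (Submodule.mkQ (LinearMap.range (delta₂On K)))

/-- The subspace `V ⊗ Sym^q V` of `V ⊗ S`. -/
def tensorSymPow (𝕜 : Type u) [Field 𝕜] (V : Type v) [AddCommGroup V] [Module 𝕜 V] (q : ℕ) :
    Submodule 𝕜 (Sym 𝕜 V ⊗[𝕜] V) :=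
  LinearMap.range ((symPow 𝕜 V q).subtype.rTensor V)

/-- The degree `q` piece `W_q(V, K)` of `W(V, K)`. The middle term of the complex is `V ⊗ S(1)`, so
this is the space of classes of cycles lying in `V ⊗ Sym^{q+1} V`. -/
def koszulPiece (K : Submodule 𝕜 (⋀[𝕜]^2 V)) (q : ℕ) :
    Submodule 𝕜 ((Sym 𝕜 V ⊗[𝕜] V) ⧸ LinearMap.range (delta₂On K)) :=
  ((LinearMap.ker (delta₁ 𝕜 V)).restrictScalars 𝕜 ⊓ tensorSymPow 𝕜 V (q + 1)).map
    ((Submodule.mkQ (LinearMap.range (delta₂On K))).restrictScalars 𝕜)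

theorem koszulPiece_le (K : Submodule 𝕜 (⋀[𝕜]^2 V)) (q : ℕ) :
    koszulPiece K q ≤ (koszulModule K).restrictScalars 𝕜 := by
  rintro _ ⟨x, hx, rfl⟩
  exact ⟨x, hx.1, rfl⟩

/-! ### Resonance -/

/-- `K^⊥ ⊆ ⋀² V^∨`: the elements whose pairing
`⟨a ∧ b, v ∧ w⟩ = a(v) b(w) - a(w) b(v)` with every element of `K` is zero. -/
def perp (K : Submodule 𝕜 (⋀[𝕜]^2 V)) : Submodule 𝕜 (⋀[𝕜]^2 (Module.Dual 𝕜 V)) :=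
  K.dualAnnihilator.comap (exteriorPower.pairingDual 𝕜 V 2)

/-- The resonance variety `R(V, K) ⊆ V^∨`. -/
def resonance (K : Submodule 𝕜 (⋀[𝕜]^2 V)) : Set (Module.Dual 𝕜 V) :=
  {a | ∃ b : Module.Dual 𝕜 V, exteriorPower.ιMulti 𝕜 2 ![a, b] ∈ perp K ∧
    exteriorPower.ιMulti 𝕜 2 ![a, b] ≠ 0} ∪ {0}

/-- The common zero locus in `V^∨` of a set of polynomial functions on `V^∨`, that is of elements
of `Sym V`. -/
def dualZeroLocus (T : Set (Sym 𝕜 V)) : Set (Module.Dual 𝕜 V) :=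
  {a | ∀ f ∈ T, symEval a f = 0}

/-- The Zariski topology on `V^∨`: the closed sets are the zero loci of polynomials. -/
@[reducible]
def zariski (𝕜 : Type u) [Field 𝕜] (V : Type v) [AddCommGroup V] [Module 𝕜 V] :
    TopologicalSpace (Module.Dual 𝕜 V) :=
  TopologicalSpace.ofClosed (Set.range (dualZeroLocus (𝕜 := 𝕜) (V := V)))
    ⟨{1}, by ext a; simp [dualZeroLocus]⟩
    (by
      intro A hA
      refine ⟨{f | ∃ T, dualZeroLocus T ∈ A ∧ f ∈ T}, ?_⟩
      ext a
      simp only [dualZeroLocus, Set.mem_ofPred_eq, Set.mem_sInter]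
      constructor
      · intro h Z hZ
        obtain ⟨T, rfl⟩ := hA hZ
        exact fun f hf => h f ⟨T, hZ, hf⟩
      · rintro h f ⟨T, hT, hf⟩
        exact h _ hT f hf)
    (by
      rintro _ ⟨T, rfl⟩ _ ⟨T', rfl⟩
      refine ⟨{h | ∃ f ∈ T, ∃ g ∈ T', h = f * g}, ?_⟩
      ext a
      simp only [dualZeroLocus, Set.mem_ofPred_eq, Set.mem_union]
      constructor
      · intro h
        by_contra! hne
        obtain ⟨⟨f, hf, hf0⟩, g, hg, hg0⟩ := hne
        have := h (f * g) ⟨f, hf, g, hg, rfl⟩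
        rw [map_mul] at this
        exact (mul_ne_zero hf0 hg0) this
      · rintro (h | h) _ ⟨f, hf, g, hg, rfl⟩
        · rw [map_mul, h f hf, zero_mul]
        · rw [map_mul, h g hg, mul_zero])

/-- The irreducible components of the resonance variety: its maximal irreducible subsets for the
Zariski topology. -/
def resonanceComponents (K : Submodule 𝕜 (⋀[𝕜]^2 V)) : Set (Set (Module.Dual 𝕜 V)) :=
  {Z | Maximal (fun Y => Y ⊆ resonance K ∧ @IsIrreducible _ (zariski 𝕜 V) Y) Z}

/-! ### Isotropic and separable subspaces -/

/-- `⋀² U` as a subspace of `⋀² V^∨`, for a subspace `U ⊆ V^∨`. -/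
def wedgeTwo (U : Submodule 𝕜 (Module.Dual 𝕜 V)) : Submodule 𝕜 (⋀[𝕜]^2 (Module.Dual 𝕜 V)) :=
  LinearMap.range (exteriorPower.map 2 (M := U) (N := Module.Dual 𝕜 V) U.subtype)

/-- The ideal of the exterior algebra `⋀ V^∨` generated by a subspace `U ⊆ V^∨`. -/
def exteriorIdeal (U : Submodule 𝕜 (Module.Dual 𝕜 V)) :
    TwoSidedIdeal (ExteriorAlgebra 𝕜 (Module.Dual 𝕜 V)) :=
  TwoSidedIdeal.span (ExteriorAlgebra.ι 𝕜 '' (U : Set (Module.Dual 𝕜 V)))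

/-- `U ⊆ V^∨` is isotropic with respect to `K`: `⋀² U ⊆ K^⊥`. -/
def IsIsotropic (K : Submodule 𝕜 (⋀[𝕜]^2 V)) (U : Submodule 𝕜 (Module.Dual 𝕜 V)) : Prop :=
  wedgeTwo U ≤ perp K

/-- `U ⊆ V^∨` is separable with respect to `K`: `K^⊥ ∩ ⟨U⟩ ⊆ ⋀² U`. -/
def IsSeparable (K : Submodule 𝕜 (⋀[𝕜]^2 V)) (U : Submodule 𝕜 (Module.Dual 𝕜 V)) : Prop :=
  ∀ w ∈ perp K, (w : ExteriorAlgebra 𝕜 (Module.Dual 𝕜 V)) ∈ exteriorIdeal U → w ∈ wedgeTwo U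

/-- `U ⊆ V^∨` is strongly isotropic with respect to `K`. -/
def IsStronglyIsotropic (K : Submodule 𝕜 (⋀[𝕜]^2 V)) (U : Submodule 𝕜 (Module.Dual 𝕜 V)) :
    Prop :=
  IsSeparable K U ∧ IsIsotropic K U

/-- The Koszul module `W(V, K)` is strongly isotropic: every irreducible component of the resonance
is a linear subspace of `V^∨`, and is strongly isotropic. -/
def StronglyIsotropicResonance (K : Submodule 𝕜 (⋀[𝕜]^2 V)) : Prop :=
  ∀ Z ∈ resonanceComponents K, ∃ U : Submodule 𝕜 (Module.Dual 𝕜 V),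
    (U : Set (Module.Dual 𝕜 V)) = Z ∧ IsStronglyIsotropic K U

end

end KoszulResonance

namespace KoszulResonance

universe u v

section Pairing

variable {𝕜 : Type u} [Field 𝕜] {V : Type v} [AddCommGroup V] [Module 𝕜 V]

/-! ### The pairing between `⋀² V^∨` and `⋀² V` -/

/-! Write `L_t ⊆ V` for the annihilator of the component `U_t`, so that `V/L_t` is dual to `U_t`.
Restricting cycles of `V ⊗ Sym V` to each `U_t` gives a map from the cycles of a given degree to the
product over `t` of the full cycle spaces of `V/L_t`. In high degrees this map is onto with kernel
exactly the boundaries coming from `K`, so `W_q` has the dimension of the product. Each factor is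
computed from the surjectivity of `δ₁` (`finrank_cycles`).

Isotropy says that boundaries restrict to zero (`tensorMap_delta₂_of_isIsotropic`). The other two
facts hold up to modules supported at the origin, which vanish in high degrees by the
Nullstellensatz (`exists_forall_mem_of_support`). It is then enough to find, at every nonzero point
`a`, a polynomial that does not vanish at `a` and multiplies one submodule into the other.

For the kernel, separability is dualised to `L ∧ V ⊆ K + ⋀²L`. Nakayama at `a` then makes every
Koszul relation involving `L` a boundary near `a` (`exists_smul_koszulSub_le`), and a contracting
homotopy moves cycles vanishing on `U_t` into such relations. Off the resonance, `L = ker a` plays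
the same role. For surjectivity, distinct components meet only in `0`
(`IsSeparable.mem_of_isIsotropic`), so linear forms vanishing on the other components but not at `a`
are available (`exists_smul_mem_map_vanishingCycles`).

The grading enters through the scaling `v ↦ 2v`, whose eigenvalues separate degrees in
characteristic zero. -/

/-- The decomposable element `v ∧ w` of `⋀² V`. -/
noncomputable abbrev wedge (v w : V) : ⋀[𝕜]^2 V := exteriorPower.ιMulti 𝕜 2 ![v, w]

theorem ιMulti_two_eq (v : Fin 2 → V) :
    exteriorPower.ιMulti 𝕜 2 v = wedge (v 0) (v 1) := by
  congr 1; ext i; fin_cases i <;> rfl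

theorem update_pair_zero {V : Type*} (v w x : V) : Function.update ![v, w] 0 x = ![x, w] := by
  ext i; fin_cases i <;> rfl

theorem update_pair_one {V : Type*} (v w x : V) : Function.update ![v, w] 1 x = ![v, x] := by
  ext i; fin_cases i <;> rfl

theorem wedge_add_left (v v' w : V) : wedge (𝕜 := 𝕜) (v + v') w = wedge v w + wedge v' w := by
  have := (exteriorPower.ιMulti 𝕜 2 (M := V)).map_update_add ![v, w] 0 v v'
  simpa only [update_pair_zero] using this

theorem wedge_add_right (v w w' : V) : wedge (𝕜 := 𝕜) v (w + w') = wedge v w + wedge v w' := by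
  have := (exteriorPower.ιMulti 𝕜 2 (M := V)).map_update_add ![v, w] 1 w w'
  simpa only [update_pair_one] using this

theorem wedge_smul_left (c : 𝕜) (v w : V) : wedge (𝕜 := 𝕜) (c • v) w = c • wedge v w := by
  have := (exteriorPower.ιMulti 𝕜 2 (M := V)).map_update_smul ![v, w] 0 c v
  simpa only [update_pair_zero] using this

theorem wedge_smul_right (c : 𝕜) (v w : V) : wedge (𝕜 := 𝕜) v (c • w) = c • wedge v w := by
  have := (exteriorPower.ιMulti 𝕜 2 (M := V)).map_update_smul ![v, w] 1 c w
  simpa only [update_pair_one] using this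

theorem wedge_self (v : V) : wedge (𝕜 := 𝕜) v v = 0 :=
  (exteriorPower.ιMulti 𝕜 2 (M := V)).map_eq_zero_of_eq _ (i := 0) (j := 1) rfl (by decide)

theorem wedge_swap (v w : V) : wedge (𝕜 := 𝕜) w v = -wedge v w := by
  have h := wedge_self (𝕜 := 𝕜) (v + w)
  rw [wedge_add_left, wedge_add_right, wedge_add_right, wedge_self, wedge_self, zero_add,
    add_zero] at h
  exact eq_neg_of_add_eq_zero_right h

/-- The wedge product as a bilinear map. -/
noncomputable def wedgeBilin (𝕜 : Type u) [Field 𝕜] (V : Type v) [AddCommGroup V] [Module 𝕜 V] :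
    V →ₗ[𝕜] V →ₗ[𝕜] ⋀[𝕜]^2 V :=
  LinearMap.mk₂ 𝕜 wedge wedge_add_left wedge_smul_left wedge_add_right wedge_smul_right

@[simp]
theorem wedgeBilin_apply (v w : V) : wedgeBilin 𝕜 V v w = wedge v w := rfl

theorem span_wedge : Submodule.span 𝕜 {x : ⋀[𝕜]^2 V | ∃ v w, x = wedge v w} = ⊤ := by
  rw [eq_top_iff, ← exteriorPower.ιMulti_span 𝕜 2 V, Submodule.span_le]
  rintro _ ⟨v, rfl⟩
  exact Submodule.subset_span ⟨_, _, ιMulti_two_eq v⟩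

theorem hom_ext_wedge {N : Type*} [AddCommGroup N] [Module 𝕜 N] {f g : ⋀[𝕜]^2 V →ₗ[𝕜] N}
    (h : ∀ v w, f (wedge v w) = g (wedge v w)) : f = g := by
  refine LinearMap.ext_on span_wedge ?_
  rintro _ ⟨v, w, rfl⟩
  exact h v w

theorem pairingDual_wedge (a b : Module.Dual 𝕜 V) (v w : V) :
    exteriorPower.pairingDual 𝕜 V 2 (wedge a b) (wedge v w) = a v * b w - a w * b v := by
  rw [exteriorPower.pairingDual_ιMulti_ιMulti, Matrix.det_fin_two]
  simp [mul_comm]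

theorem map_wedge {W : Type*} [AddCommGroup W] [Module 𝕜 W] (f : V →ₗ[𝕜] W) (v w : V) :
    exteriorPower.map 2 f (wedge v w) = wedge (f v) (f w) := by
  rw [exteriorPower.map_apply_ιMulti, ιMulti_two_eq]; rfl

theorem coe_wedge (v w : V) : ((wedge v w : ⋀[𝕜]^2 V) : ExteriorAlgebra 𝕜 V) =
    ExteriorAlgebra.ι 𝕜 v * ExteriorAlgebra.ι 𝕜 w := by
  rw [exteriorPower.ιMulti_apply_coe, ExteriorAlgebra.ιMulti_apply]
  simp

theorem pairingDual_map_dualMap (p : V →ₗ[𝕜] V) (w : ⋀[𝕜]^2 (Module.Dual 𝕜 V)) (x y : V) :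
    exteriorPower.pairingDual 𝕜 V 2 (exteriorPower.map 2 p.dualMap w) (wedge x y) =
      exteriorPower.pairingDual 𝕜 V 2 w (wedge (p x) (p y)) := by
  have : (exteriorPower.pairingDual 𝕜 V 2).flip (wedge x y) ∘ₗ exteriorPower.map 2 p.dualMap =
      (exteriorPower.pairingDual 𝕜 V 2).flip (wedge (p x) (p y)) := by
    apply hom_ext_wedge
    intro a b
    simp only [LinearMap.comp_apply, LinearMap.flip_apply, map_wedge, pairingDual_wedge]
    rfl
  exact DFunLike.congr_fun this w

/-! ### Perfectness of the pairing in characteristic zero -/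

section Basis

variable [FiniteDimensional 𝕜 V]

/-- The inverse of the pairing `⋀² V^∨ → (⋀² V)^∨`, in coordinates. -/
noncomputable def pairingInv (𝕜 : Type u) [Field 𝕜] (V : Type v) [AddCommGroup V] [Module 𝕜 V]
    [FiniteDimensional 𝕜 V] : Module.Dual 𝕜 (⋀[𝕜]^2 V) →ₗ[𝕜] ⋀[𝕜]^2 (Module.Dual 𝕜 V) :=
  (2 : 𝕜)⁻¹ • ∑ i, ∑ j,
    (Module.Dual.eval 𝕜 _ (wedge (Module.finBasis 𝕜 V i) (Module.finBasis 𝕜 V j))).smulRight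
      (wedge ((Module.finBasis 𝕜 V).coord i) ((Module.finBasis 𝕜 V).coord j))

theorem pairingInv_apply (g : Module.Dual 𝕜 (⋀[𝕜]^2 V)) : pairingInv 𝕜 V g =
    (2 : 𝕜)⁻¹ • ∑ i, ∑ j, g (wedge (Module.finBasis 𝕜 V i) (Module.finBasis 𝕜 V j)) •
      wedge ((Module.finBasis 𝕜 V).coord i) ((Module.finBasis 𝕜 V).coord j) := by
  simp [pairingInv, LinearMap.sum_apply]

theorem bilin_sum_coord {N : Type*} [AddCommGroup N] [Module 𝕜 N]
    (B : V →ₗ[𝕜] V →ₗ[𝕜] N) (v w : V) :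
    ∑ i, ∑ j, ((Module.finBasis 𝕜 V).coord i v * (Module.finBasis 𝕜 V).coord j w) •
      B (Module.finBasis 𝕜 V i) (Module.finBasis 𝕜 V j) = B v w := by
  conv_rhs => rw [← (Module.finBasis 𝕜 V).sum_repr v, ← (Module.finBasis 𝕜 V).sum_repr w]
  simp only [map_sum, LinearMap.sum_apply, map_smul, LinearMap.smul_apply, mul_smul,
    Module.Basis.coord_apply, Finset.smul_sum]
  rw [Finset.sum_comm]
  exact Finset.sum_congr rfl fun i _ => Finset.sum_congr rfl fun j _ => smul_comm _ _ _

theorem bilin_sum_dual {N : Type*} [AddCommGroup N] [Module 𝕜 N]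
    (B : Module.Dual 𝕜 V →ₗ[𝕜] Module.Dual 𝕜 V →ₗ[𝕜] N) (a b : Module.Dual 𝕜 V) :
    ∑ i, ∑ j, (a (Module.finBasis 𝕜 V i) * b (Module.finBasis 𝕜 V j)) •
      B ((Module.finBasis 𝕜 V).coord i) ((Module.finBasis 𝕜 V).coord j) = B a b := by
  have key : ∀ a : Module.Dual 𝕜 V,
      a = ∑ i, a (Module.finBasis 𝕜 V i) • (Module.finBasis 𝕜 V).coord i := by
    intro a
    refine (Module.finBasis 𝕜 V).ext fun j => ?_
    simp
  conv_rhs => rw [key a, key b]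
  simp only [map_sum, LinearMap.sum_apply, map_smul, LinearMap.smul_apply, mul_smul,
    Finset.smul_sum]
  rw [Finset.sum_comm]
  exact Finset.sum_congr rfl fun i _ => Finset.sum_congr rfl fun j _ => smul_comm _ _ _

theorem bilin_sum_dual_sub {N : Type*} [AddCommGroup N] [Module 𝕜 N]
    (B : Module.Dual 𝕜 V →ₗ[𝕜] Module.Dual 𝕜 V →ₗ[𝕜] N) (a b : Module.Dual 𝕜 V) :
    ∑ i, ∑ j, (a (Module.finBasis 𝕜 V i) * b (Module.finBasis 𝕜 V j) -
      a (Module.finBasis 𝕜 V j) * b (Module.finBasis 𝕜 V i)) •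
      B ((Module.finBasis 𝕜 V).coord i) ((Module.finBasis 𝕜 V).coord j) = B a b - B b a := by
  simp only [sub_smul, Finset.sum_sub_distrib, bilin_sum_dual B a b]
  rw [← bilin_sum_dual B b a]
  simp_rw [mul_comm]

variable [CharZero 𝕜]

/-- The coordinate sum runs over ordered pairs, so each basis bivector occurs twice up to a sign
that cancels; the factor `2⁻¹` corrects this. -/
theorem pairingDual_pairingInv (g : Module.Dual 𝕜 (⋀[𝕜]^2 V)) :
    exteriorPower.pairingDual 𝕜 V 2 (pairingInv 𝕜 V g) = g := by
  apply hom_ext_wedge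
  intro v w
  have h1 := bilin_sum_coord ((wedgeBilin 𝕜 V).compr₂ g) v w
  have h2 := bilin_sum_coord ((wedgeBilin 𝕜 V).compr₂ g) w v
  simp only [LinearMap.compr₂_apply, wedgeBilin_apply] at h1 h2
  have h3 : ∑ i, ∑ j, g (wedge (Module.finBasis 𝕜 V i) (Module.finBasis 𝕜 V j)) *
      ((Module.finBasis 𝕜 V).coord i v * (Module.finBasis 𝕜 V).coord j w -
        (Module.finBasis 𝕜 V).coord i w * (Module.finBasis 𝕜 V).coord j v) =
      2 * g (wedge v w) := by
    have h4 : 2 * g (wedge v w) = g (wedge v w) - g (wedge w v) := by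
      rw [wedge_swap v w, map_neg]; ring
    rw [h4, ← h1, ← h2]
    simp only [mul_sub, Finset.sum_sub_distrib, smul_eq_mul]
    simp_rw [mul_comm]
  simp only [pairingInv_apply, map_smul, map_sum, LinearMap.smul_apply, LinearMap.sum_apply,
    pairingDual_wedge, smul_eq_mul]
  rw [h3, inv_mul_cancel_left₀ two_ne_zero]

theorem pairingInv_pairingDual (w : ⋀[𝕜]^2 (Module.Dual 𝕜 V)) :
    pairingInv 𝕜 V (exteriorPower.pairingDual 𝕜 V 2 w) = w := by
  have : pairingInv 𝕜 V ∘ₗ exteriorPower.pairingDual 𝕜 V 2 = LinearMap.id := by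
    apply hom_ext_wedge
    intro a b
    have h3 := bilin_sum_dual_sub (wedgeBilin 𝕜 (Module.Dual 𝕜 V)) a b
    simp only [wedgeBilin_apply] at h3
    simp only [LinearMap.comp_apply, pairingInv_apply, pairingDual_wedge, LinearMap.id_apply]
    rw [h3, wedge_swap a b, sub_neg_eq_add, ← two_smul 𝕜, inv_smul_smul₀ two_ne_zero]
  exact DFunLike.congr_fun this w

end Basis

end Pairing

section Resonance

variable {𝕜 : Type u} [Field 𝕜] {V : Type v} [AddCommGroup V] [Module 𝕜 V]

/-! ### Isotropic and separable subspaces -/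

/-- The image of `⋀² L` in `⋀² V`. -/
noncomputable def wedgeSub (L : Submodule 𝕜 V) : Submodule 𝕜 (⋀[𝕜]^2 V) :=
  Submodule.span 𝕜 {x | ∃ l ∈ L, ∃ l' ∈ L, x = wedge l l'}

theorem mem_perp {K : Submodule 𝕜 (⋀[𝕜]^2 V)} {w : ⋀[𝕜]^2 (Module.Dual 𝕜 V)} :
    w ∈ perp K ↔ ∀ κ ∈ K, exteriorPower.pairingDual 𝕜 V 2 w κ = 0 := by
  simp [perp, Submodule.mem_dualAnnihilator]

theorem wedge_mem_exteriorIdeal_left {U : Submodule 𝕜 (Module.Dual 𝕜 V)} {a : Module.Dual 𝕜 V}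
    (ha : a ∈ U) (b : Module.Dual 𝕜 V) :
    ((wedge a b : ⋀[𝕜]^2 (Module.Dual 𝕜 V)) : ExteriorAlgebra 𝕜 (Module.Dual 𝕜 V)) ∈
      exteriorIdeal U := by
  rw [coe_wedge]
  exact TwoSidedIdeal.mul_mem_right _ _ _ (TwoSidedIdeal.subset_span ⟨a, ha, rfl⟩)

theorem wedge_mem_exteriorIdeal_right {U : Submodule 𝕜 (Module.Dual 𝕜 V)} {b : Module.Dual 𝕜 V}
    (a : Module.Dual 𝕜 V) (hb : b ∈ U) :
    ((wedge a b : ⋀[𝕜]^2 (Module.Dual 𝕜 V)) : ExteriorAlgebra 𝕜 (Module.Dual 𝕜 V)) ∈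
      exteriorIdeal U := by
  rw [coe_wedge]
  exact TwoSidedIdeal.mul_mem_left _ _ _ (TwoSidedIdeal.subset_span ⟨b, hb, rfl⟩)

/-- The elements of degree two of the ideal generated by `U`, as a subspace of `⋀² V^∨`. -/
def idealTwo (U : Submodule 𝕜 (Module.Dual 𝕜 V)) : Submodule 𝕜 (⋀[𝕜]^2 (Module.Dual 𝕜 V)) where
  carrier := {w | (w : ExteriorAlgebra 𝕜 (Module.Dual 𝕜 V)) ∈ exteriorIdeal U}
  zero_mem' := by simp
  add_mem' {x y} hx hy := by simpa using TwoSidedIdeal.add_mem _ hx hy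
  smul_mem' c x hx := by
    simpa [Algebra.smul_def] using TwoSidedIdeal.mul_mem_left _ _ _ hx

/-- Telescoping: `a ∧ b - Pa ∧ Pb = (a - Pa) ∧ b + Pa ∧ (b - Pb)`. If `P` also kills `w`, this
places `w` itself in the ideal. -/
theorem sub_map_mem_idealTwo {U : Submodule 𝕜 (Module.Dual 𝕜 V)}
    {P : Module.Dual 𝕜 V →ₗ[𝕜] Module.Dual 𝕜 V} (hP : ∀ φ, φ - P φ ∈ U)
    (w : ⋀[𝕜]^2 (Module.Dual 𝕜 V)) : w - exteriorPower.map 2 P w ∈ idealTwo U := by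
  have hw : w ∈ Submodule.span 𝕜 {x : ⋀[𝕜]^2 (Module.Dual 𝕜 V) | ∃ v w, x = wedge v w} := by
    rw [span_wedge]; trivial
  have : Submodule.span 𝕜 {x : ⋀[𝕜]^2 (Module.Dual 𝕜 V) | ∃ v w, x = wedge v w} ≤
      (idealTwo U).comap (LinearMap.id - exteriorPower.map 2 P) := by
    rw [Submodule.span_le]
    rintro _ ⟨a, b, rfl⟩
    have e : wedge (𝕜 := 𝕜) a b - wedge (P a) (P b) = wedge (a - P a) b + wedge (P a) (b - P b) := by
      have h1 := wedge_add_left (𝕜 := 𝕜) (a - P a) (P a) b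
      have h2 := wedge_add_right (𝕜 := 𝕜) (P a) (b - P b) (P b)
      rw [sub_add_cancel] at h1 h2
      rw [h1, h2]; abel
    change _ - exteriorPower.map 2 P _ ∈ idealTwo U
    rw [LinearMap.id_apply, map_wedge, e]
    exact add_mem (wedge_mem_exteriorIdeal_left (hP a) b) (wedge_mem_exteriorIdeal_right _ (hP b))
  exact this hw

theorem bilin_sub_smul {M N : Type*} [AddCommGroup M] [Module 𝕜 M] [AddCommGroup N] [Module 𝕜 N]
    (B : M →ₗ[𝕜] M →ₗ[𝕜] N) (h0 : ∀ x, B x x = 0) (hB : ∀ x y, B x y = -B y x)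
    (a x y : M) (r s : 𝕜) :
    B x y - B (x - r • a) (y - s • a) = B a (r • y - s • x) := by
  simp only [map_sub, map_smul, LinearMap.sub_apply, LinearMap.smul_apply, h0, hB x a]
  module

/-- When `P` moves every functional along the single line spanned by `a`, the difference is one
decomposable `a ∧ b`, which is the shape occurring in the definition of resonance. -/
theorem sub_map_mem_range {a : Module.Dual 𝕜 V} {P : Module.Dual 𝕜 V →ₗ[𝕜] Module.Dual 𝕜 V}
    {g : Module.Dual 𝕜 V → 𝕜} (hP : ∀ φ, P φ = φ - g φ • a) (w : ⋀[𝕜]^2 (Module.Dual 𝕜 V)) :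
    ∃ b, w - exteriorPower.map 2 P w = wedge a b := by
  have hw : w ∈ Submodule.span 𝕜 {x : ⋀[𝕜]^2 (Module.Dual 𝕜 V) | ∃ v w, x = wedge v w} := by
    rw [span_wedge]; trivial
  have : Submodule.span 𝕜 {x : ⋀[𝕜]^2 (Module.Dual 𝕜 V) | ∃ v w, x = wedge v w} ≤
      (LinearMap.range (wedgeBilin 𝕜 _ a)).comap (LinearMap.id - exteriorPower.map 2 P) := by
    rw [Submodule.span_le]
    rintro _ ⟨φ, ψ, rfl⟩
    refine ⟨g φ • ψ - g ψ • φ, ?_⟩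
    change _ = wedge φ ψ - exteriorPower.map 2 P (wedge φ ψ)
    rw [map_wedge, hP, hP]
    exact (bilin_sub_smul (wedgeBilin 𝕜 (Module.Dual 𝕜 V)) (fun x => wedge_self x)
      (fun x y => wedge_swap y x) a φ ψ (g φ) (g ψ)).symm
  obtain ⟨b, hb⟩ := this hw
  exact ⟨b, hb.symm⟩

theorem pairingDual_wedgeTwo {U : Submodule 𝕜 (Module.Dual 𝕜 V)}
    {w : ⋀[𝕜]^2 (Module.Dual 𝕜 V)} (hw : w ∈ wedgeTwo U) {l : V} (hl : l ∈ U.dualCoannihilator)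
    (v : V) : exteriorPower.pairingDual 𝕜 V 2 w (wedge l v) = 0 := by
  obtain ⟨y, rfl⟩ := hw
  have : (exteriorPower.pairingDual 𝕜 V 2).flip (wedge l v) ∘ₗ
      exteriorPower.map 2 (M := U) (N := Module.Dual 𝕜 V) U.subtype = 0 := by
    apply hom_ext_wedge
    intro a b
    rw [Submodule.mem_dualCoannihilator] at hl
    simp only [LinearMap.comp_apply, LinearMap.flip_apply, map_wedge, pairingDual_wedge,
      Submodule.subtype_apply, hl _ a.2, hl _ b.2]
    simp
  exact DFunLike.congr_fun this y

theorem wedge_mem_wedgeTwo {U : Submodule 𝕜 (Module.Dual 𝕜 V)} {a b : Module.Dual 𝕜 V}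
    (ha : a ∈ U) (hb : b ∈ U) : wedge a b ∈ wedgeTwo U :=
  ⟨wedge ⟨a, ha⟩ ⟨b, hb⟩, map_wedge _ _ _⟩

theorem exists_eq_one {a : Module.Dual 𝕜 V} (ha : a ≠ 0) : ∃ c, a c = 1 := by
  obtain ⟨x, hx⟩ := DFunLike.ne_iff.1 ha
  exact ⟨(a x)⁻¹ • x, by simpa using inv_mul_cancel₀ hx⟩

variable [FiniteDimensional 𝕜 V] [CharZero 𝕜]

/-- Double annihilator: a functional separating `x` from `P` is represented by an element of `⋀²
V^∨`, since the pairing is onto. -/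
theorem mem_of_pairingDual {P : Submodule 𝕜 (⋀[𝕜]^2 V)} {x : ⋀[𝕜]^2 V}
    (h : ∀ w : ⋀[𝕜]^2 (Module.Dual 𝕜 V), w ∈ perp P →
      exteriorPower.pairingDual 𝕜 V 2 w x = 0) : x ∈ P := by
  by_contra hx
  obtain ⟨g, hgx, hg⟩ := Submodule.exists_le_ker_of_notMem hx
  refine hgx ?_
  have := h (pairingInv 𝕜 V g)
  rw [mem_perp, pairingDual_pairingInv] at this
  exact this fun κ hκ => hg hκ

/-- Pairing the image with `x ∧ y` amounts to pairing `w` with `px ∧ py ∈ ⋀² L`, which gives zero;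
the pairing is injective. -/
theorem map_dualMap_eq_zero {L : Submodule 𝕜 V} {p : V →ₗ[𝕜] V} (hp : ∀ v, p v ∈ L)
    {w : ⋀[𝕜]^2 (Module.Dual 𝕜 V)} (hw : w ∈ perp (wedgeSub L)) :
    exteriorPower.map 2 p.dualMap w = 0 := by
  rw [← pairingInv_pairingDual (exteriorPower.map 2 p.dualMap w)]
  refine (congrArg _ (?_ : _ = (0 : Module.Dual 𝕜 (⋀[𝕜]^2 V)))).trans
    (LinearMap.map_zero (pairingInv 𝕜 V))
  apply hom_ext_wedge
  intro x y
  rw [pairingDual_map_dualMap]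
  exact mem_perp.1 hw _ (Submodule.subset_span ⟨_, hp x, _, hp y, rfl⟩)

omit [FiniteDimensional 𝕜 V] [CharZero 𝕜] in
theorem perp_sup {K K' : Submodule 𝕜 (⋀[𝕜]^2 V)} : perp (K ⊔ K') = perp K ⊓ perp K' := by
  simp [perp, Submodule.dualAnnihilator_sup_eq]

/-- The dual form of separability. -/
theorem IsSeparable.wedge_mem {K : Submodule 𝕜 (⋀[𝕜]^2 V)}
    {U : Submodule 𝕜 (Module.Dual 𝕜 V)} (h : IsSeparable K U) {l : V}
    (hl : l ∈ U.dualCoannihilator) (v : V) :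
    wedge l v ∈ K ⊔ wedgeSub U.dualCoannihilator := by
  refine mem_of_pairingDual fun w hw => ?_
  rw [perp_sup] at hw
  obtain ⟨g, hg⟩ := U.dualCoannihilator.subtype.exists_leftInverse_of_injective
    (Submodule.ker_subtype _)
  set p : V →ₗ[𝕜] V := U.dualCoannihilator.subtype ∘ₗ g with hp
  -- `p` is a projection onto `L = U^⊥`. Its transpose kills `w` and changes functionals only by
  -- elements of `U`, so `w` lies in `⟨U⟩`; separability puts it in `⋀² U`, which pairs to zero with
  -- `L ∧ V`.
  have h0 := map_dualMap_eq_zero (p := p) (fun v => (g v).2) hw.2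
  refine pairingDual_wedgeTwo (h w hw.1 ?_) hl v
  have := sub_map_mem_idealTwo (U := U) (P := p.dualMap) (fun φ => ?_) w
  · rw [h0, sub_zero] at this
    exact this
  · rw [← Subspace.dualCoannihilator_dualAnnihilator_eq (W := U), Submodule.mem_dualAnnihilator]
    intro l hl
    have : g l = ⟨l, hl⟩ := DFunLike.congr_fun hg ⟨l, hl⟩
    simp [hp, this]

/-- Project onto `ker a` along a vector `c` with `a c = 1`. An element orthogonal to both `K` and
`⋀² ker a` then has the form `a ∧ b`, and it vanishes because `a` is not resonant. -/
theorem wedge_mem_of_notMem_resonance {K : Submodule 𝕜 (⋀[𝕜]^2 V)} {a : Module.Dual 𝕜 V}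
    (ha : a ∉ resonance K) (l v : V) :
    wedge l v ∈ K ⊔ wedgeSub (LinearMap.ker a) := by
  have ha0 : a ≠ 0 := fun h => ha (Or.inr h)
  obtain ⟨c, hc⟩ := exists_eq_one ha0
  refine mem_of_pairingDual fun w hw => ?_
  rw [perp_sup] at hw
  have h0 := map_dualMap_eq_zero (p := LinearMap.id - a.smulRight c)
    (fun v => by simp [hc]) hw.2
  obtain ⟨b, hb⟩ := sub_map_mem_range (a := a) (g := fun φ => φ c)
    (P := (LinearMap.id - a.smulRight c).dualMap)
    (fun φ => by ext; simp [mul_comm]) w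
  rw [h0, sub_zero] at hb
  have : w = 0 := by
    by_contra hw0
    subst hb
    exact ha (Or.inl ⟨b, hw.1, hw0⟩)
  simp [this]

omit [CharZero 𝕜] in
-- For `b ∈ U'`, isotropy and separability force `a ∧ b ∈ ⋀² U`. Pairing with `l ∧ v`, where `l`
-- annihilates `U` and `a v ≠ 0`, leaves `b l = 0`. Used in both directions, this shows that
-- distinct components meet only in `0`.
theorem IsSeparable.mem_of_isIsotropic {K : Submodule 𝕜 (⋀[𝕜]^2 V)}
    {U U' : Submodule 𝕜 (Module.Dual 𝕜 V)} (h : IsSeparable K U) (h' : IsIsotropic K U')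
    {a : Module.Dual 𝕜 V} (ha0 : a ≠ 0) (ha : a ∈ U) (ha' : a ∈ U') : U' ≤ U := by
  intro b hb
  have hab := h _ (h' (wedge_mem_wedgeTwo ha' hb)) (wedge_mem_exteriorIdeal_left ha b)
  obtain ⟨v, hv⟩ := DFunLike.ne_iff.1 ha0
  rw [← Subspace.dualCoannihilator_dualAnnihilator_eq (W := U), Submodule.mem_dualAnnihilator]
  intro l hl
  have := pairingDual_wedgeTwo hab hl v
  rw [pairingDual_wedge, (Submodule.mem_dualCoannihilator _).1 hl a ha, zero_mul, zero_sub,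
    neg_eq_zero] at this
  exact (mul_eq_zero.1 this).resolve_left hv

/-! ### Irreducible components -/

omit [CharZero 𝕜] [FiniteDimensional 𝕜 V] in
-- Zorn, starting from the singleton `{a}`: two open sets that meet the union of a chain of
-- irreducible sets both meet a single member of the chain.
theorem exists_resonanceComponent {K : Submodule 𝕜 (⋀[𝕜]^2 V)} {a : Module.Dual 𝕜 V}
    (ha : a ∈ resonance K) : ∃ Z ∈ resonanceComponents K, a ∈ Z := by
  let _ := zariski 𝕜 V
  obtain ⟨m, ham, hm⟩ := zorn_subset_nonempty
    {Y : Set (Module.Dual 𝕜 V) | Y ⊆ resonance K ∧ IsIrreducible Y}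
    (fun c hc hcc hne => by
      obtain ⟨Y₀, hY₀⟩ := hne
      refine ⟨⋃₀ c, ⟨Set.sUnion_subset fun Y hY => (hc hY).1, ?_, ?_⟩,
        fun s hs => Set.subset_sUnion_of_mem hs⟩
      · exact (hc hY₀).2.1.mono (Set.subset_sUnion_of_mem hY₀)
      · rintro u v hu hv ⟨y, ⟨p, hp, hyp⟩, hyu⟩ ⟨x, ⟨q, hq, hxq⟩, hxv⟩
        rcases hcc.total hp hq with hpq | hqp
        · obtain ⟨z, hz, hzuv⟩ := (hc hq).2.2 u v hu hv ⟨y, hpq hyp, hyu⟩ ⟨x, hxq, hxv⟩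
          exact ⟨z, ⟨q, hq, hz⟩, hzuv⟩
        · obtain ⟨z, hz, hzuv⟩ := (hc hp).2.2 u v hu hv ⟨y, hyp, hyu⟩ ⟨x, hqp hxq, hxv⟩
          exact ⟨z, ⟨p, hp, hz⟩, hzuv⟩)
    {a} ⟨Set.singleton_subset_iff.2 ha, isIrreducible_singleton⟩
  exact ⟨m, hm, ham rfl⟩

end Resonance

section KoszulRelations

variable {𝕜 : Type u} [Field 𝕜] {V : Type v} [AddCommGroup V] [Module 𝕜 V]
  {W : Type*} [AddCommGroup W] [Module 𝕜 W]

/-! ### Symmetric algebras -/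

theorem symHom_ext {A : Type*} [CommRing A] [Algebra 𝕜 A] {F G : Sym 𝕜 V →ₐ[𝕜] A}
    (h : ∀ v, F (symι 𝕜 V v) = G (symι 𝕜 V v)) : F = G :=
  SymmetricAlgebra.algHom_ext (LinearMap.ext h)

/-- The algebra map `Sym V → Sym W` induced by a linear map. -/
noncomputable def symMap (f : V →ₗ[𝕜] W) : Sym 𝕜 V →ₐ[𝕜] Sym 𝕜 W :=
  SymmetricAlgebra.lift (symι 𝕜 W ∘ₗ f)

@[simp]
theorem symMap_symι (f : V →ₗ[𝕜] W) (v : V) : symMap f (symι 𝕜 V v) = symι 𝕜 W (f v) :=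
  SymmetricAlgebra.lift_ι_apply _ v

theorem symMap_symMap {X : Type*} [AddCommGroup X] [Module 𝕜 X] (g : W →ₗ[𝕜] X) (f : V →ₗ[𝕜] W)
    (s : Sym 𝕜 V) : symMap g (symMap f s) = symMap (g ∘ₗ f) s := by
  have : (symMap g).comp (symMap f) = symMap (g ∘ₗ f) := symHom_ext fun v => by simp
  exact DFunLike.congr_fun this s

theorem symMap_id (s : Sym 𝕜 V) : symMap LinearMap.id s = s := by
  have : symMap LinearMap.id = AlgHom.id 𝕜 (Sym 𝕜 V) := symHom_ext fun v => by simp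
  exact DFunLike.congr_fun this s

theorem symEval_symMap (b : Module.Dual 𝕜 W) (f : V →ₗ[𝕜] W) (s : Sym 𝕜 V) :
    symEval b (symMap f s) = symEval (b ∘ₗ f) s := by
  have : (symEval b).comp (symMap f) = symEval (b ∘ₗ f) :=
    symHom_ext fun v => by simp [symEval_symι]
  exact DFunLike.congr_fun this s

theorem symMap_surjective {f : V →ₗ[𝕜] W} (hf : Function.Surjective f) :
    Function.Surjective (symMap f) := by
  obtain ⟨g, hg⟩ := f.exists_rightInverse_of_surjective (LinearMap.range_eq_top.2 hf)
  intro s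
  exact ⟨symMap g s, by rw [symMap_symMap, hg, symMap_id]⟩

/-- The symmetric algebra in coordinates. -/
noncomputable def symEquiv {ι : Type*} (b : Module.Basis ι 𝕜 V) :
    Sym 𝕜 V ≃ₐ[𝕜] MvPolynomial ι 𝕜 :=
  SymmetricAlgebra.equivMvPolynomial b

theorem symEquiv_symι {ι : Type*} (b : Module.Basis ι 𝕜 V) (i : ι) :
    symEquiv b (symι 𝕜 V (b i)) = MvPolynomial.X i :=
  SymmetricAlgebra.equivMvPolynomial_ι_apply b i

instance [FiniteDimensional 𝕜 V] : Algebra.FiniteType 𝕜 (Sym 𝕜 V) :=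
  .equiv inferInstance (symEquiv (Module.finBasis 𝕜 V)).symm

instance [FiniteDimensional 𝕜 V] : IsNoetherianRing (Sym 𝕜 V) :=
  Algebra.FiniteType.isNoetherianRing 𝕜 _

/-- Modulo the ideal, `symMap p` and the identity are algebra maps that agree on generators. -/
theorem sub_symMap_mem {L : Submodule 𝕜 V} {p : V →ₗ[𝕜] V} (hp : ∀ v, v - p v ∈ L)
    (s : Sym 𝕜 V) : s - symMap p s ∈ Ideal.span (symι 𝕜 V '' L) := by
  have : (Ideal.Quotient.mkₐ 𝕜 (Ideal.span (symι 𝕜 V '' L))).comp (symMap p) =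
      Ideal.Quotient.mkₐ 𝕜 (Ideal.span (symι 𝕜 V '' L)) := by
    refine symHom_ext fun v => Eq.symm ?_
    rw [AlgHom.comp_apply, symMap_symι]
    refine Ideal.Quotient.eq.2 ?_
    rw [← map_sub]
    exact Ideal.subset_span ⟨_, hp v, rfl⟩
  exact Ideal.Quotient.eq.1 (DFunLike.congr_fun this s).symm

/-! ### Koszul relations -/

/-- The Koszul relation between two linear forms. -/
noncomputable def koszulRel (𝕜 : Type u) [Field 𝕜] {V : Type v} [AddCommGroup V] [Module 𝕜 V]
    (v w : V) : Sym 𝕜 V ⊗[𝕜] V :=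
  symι 𝕜 V v ⊗ₜ w - symι 𝕜 V w ⊗ₜ v

theorem delta₁_tmul (s : Sym 𝕜 V) (v : V) : delta₁ 𝕜 V (s ⊗ₜ v) = s * symι 𝕜 V v := by
  simp [delta₁]

theorem delta₂_wedge (v w : V) : delta₂ 𝕜 V (1 ⊗ₜ wedge v w) = koszulRel 𝕜 v w := by
  rw [delta₂_tmul, mul_one, mul_one, koszulRel]

theorem koszulRel_swap (v w : V) : koszulRel 𝕜 w v = -koszulRel 𝕜 v w := by
  simp [koszulRel]

theorem koszulRel_add_right (v w w' : V) :
    koszulRel 𝕜 v (w + w') = koszulRel 𝕜 v w + koszulRel 𝕜 v w' := by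
  simp only [koszulRel, map_add, TensorProduct.tmul_add, TensorProduct.add_tmul]
  abel

theorem koszulRel_smul_self (v : V) (t : 𝕜) : koszulRel 𝕜 v (t • v) = 0 := by
  simp [koszulRel, TensorProduct.smul_tmul]

/-- This is `δ₂ ∘ δ₃ = 0` evaluated on `a ∧ b ∧ c`. -/
theorem smul_koszulRel (a b c : V) :
    symι 𝕜 V a • koszulRel 𝕜 b c =
      symι 𝕜 V b • koszulRel 𝕜 a c - symι 𝕜 V c • koszulRel 𝕜 a b := by
  simp only [koszulRel, smul_sub, TensorProduct.smul_tmul', smul_eq_mul]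
  rw [mul_comm (symι 𝕜 V b) (symι 𝕜 V a), mul_comm (symι 𝕜 V c) (symι 𝕜 V a),
    mul_comm (symι 𝕜 V c) (symι 𝕜 V b)]
  abel

/-- The submodule generated by the Koszul relations that involve a linear form in `L`. -/
noncomputable def koszulSub (L : Submodule 𝕜 V) : Submodule (Sym 𝕜 V) (Sym 𝕜 V ⊗[𝕜] V) :=
  Submodule.span _ {x | ∃ l ∈ L, ∃ v, x = koszulRel 𝕜 l v}

theorem koszulRel_mem_koszulSub {L : Submodule 𝕜 V} {l : V} (hl : l ∈ L) (v : V) :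
    koszulRel 𝕜 l v ∈ koszulSub L :=
  Submodule.subset_span ⟨l, hl, v, rfl⟩

theorem koszulRel_mem_koszulSub' {L : Submodule 𝕜 V} {l : V} (hl : l ∈ L) (v : V) :
    koszulRel 𝕜 v l ∈ koszulSub L := by
  rw [koszulRel_swap]
  exact neg_mem (koszulRel_mem_koszulSub hl v)

/-- The homotopy `x ↦ c x - c ⊗ δ₁ x`. -/
noncomputable def homotopy (c : V) : Sym 𝕜 V ⊗[𝕜] V →ₗ[Sym 𝕜 V] Sym 𝕜 V ⊗[𝕜] V :=
  symι 𝕜 V c • LinearMap.id -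
    LinearMap.toSpanSingleton (Sym 𝕜 V) (Sym 𝕜 V ⊗[𝕜] V) (1 ⊗ₜ c) ∘ₗ delta₁ 𝕜 V

theorem homotopy_apply (c : V) (x : Sym 𝕜 V ⊗[𝕜] V) :
    homotopy c x = symι 𝕜 V c • x - delta₁ 𝕜 V x ⊗ₜ c := by
  simp [homotopy, TensorProduct.smul_tmul']

/-- The homotopy is `δ₂` after wedging with `c`. As it is multiplication by `c` on cycles, `c` times
a cycle is a combination of Koszul relations involving `c`. -/
theorem homotopy_tmul (c : V) (s : Sym 𝕜 V) (v : V) :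
    homotopy c (s ⊗ₜ v) = s • koszulRel 𝕜 c v := by
  simp only [homotopy_apply, delta₁_tmul, koszulRel, smul_sub, TensorProduct.smul_tmul',
    smul_eq_mul]
  rw [mul_comm s, mul_comm s]

theorem delta₁_homotopy (c : V) (x : Sym 𝕜 V ⊗[𝕜] V) : delta₁ 𝕜 V (homotopy c x) = 0 := by
  rw [homotopy_apply, map_sub, map_smul, delta₁_tmul, smul_eq_mul, mul_comm, sub_self]

theorem homotopy_of_mem_ker (c : V) {x : Sym 𝕜 V ⊗[𝕜] V} (hx : delta₁ 𝕜 V x = 0) :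
    homotopy c x = symι 𝕜 V c • x := by
  rw [homotopy_apply, hx, TensorProduct.zero_tmul, sub_zero]

/-- The hypothesis describes elements that die in `V/L ⊗ Sym(V/L)`. A coefficient `l ∈ L` is moved
into the relation by the Koszul identity, writing `R` for `koszulRel`: `l R(c,v) = c R(l,v) - v
R(l,c)`. -/
theorem homotopy_mem_koszulSub_of_mem {L : Submodule 𝕜 V} (c : V) {x : Sym 𝕜 V ⊗[𝕜] V}
    (hx : x ∈ Ideal.span (symι 𝕜 V '' L) • (⊤ : Submodule (Sym 𝕜 V) (Sym 𝕜 V ⊗[𝕜] V)) ⊔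
      Submodule.span _ {y | ∃ l ∈ L, y = 1 ⊗ₜ l}) :
    homotopy c x ∈ koszulSub L := by
  suffices h : _ ≤ (koszulSub L).comap (homotopy c) from h hx
  refine sup_le ?_ (Submodule.span_le.2 ?_)
  · refine Submodule.smul_le.2 fun r hr x _ => ?_
    rw [Submodule.mem_comap, map_smul]
    induction hr using Submodule.span_induction with
    | mem r hr =>
      obtain ⟨l, hl, rfl⟩ := hr
      induction x with
      | zero => simp
      | add x y hx hy => rw [map_add, smul_add]; exact add_mem (hx trivial) (hy trivial)
      | tmul s v =>
        rw [homotopy_tmul, smul_comm, smul_koszulRel]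
        exact Submodule.smul_mem _ _ (sub_mem
          (Submodule.smul_mem _ _ (koszulRel_mem_koszulSub hl v))
          (Submodule.smul_mem _ _ (koszulRel_mem_koszulSub hl c)))
    | zero => simp
    | add r r' _ _ h h' => rw [add_smul]; exact add_mem h h'
    | smul t r _ h => rw [smul_assoc]; exact Submodule.smul_mem _ _ h
  · rintro _ ⟨l, hl, rfl⟩
    rw [SetLike.mem_coe, Submodule.mem_comap, homotopy_tmul, one_smul]
    exact koszulRel_mem_koszulSub' hl c

/-- Replacing `v` by `v - a(v) c` leaves the relation between `c` and `v` unchanged and puts the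
second entry in `ker a`. -/
theorem homotopy_mem_koszulSub_of_ker {a : Module.Dual 𝕜 V} {c : V} (hc : a c = 1)
    (x : Sym 𝕜 V ⊗[𝕜] V) : homotopy c x ∈ koszulSub (LinearMap.ker a) := by
  induction x with
  | zero => simp
  | add x y hx hy => rw [map_add]; exact add_mem hx hy
  | tmul s v =>
    rw [homotopy_tmul]
    refine Submodule.smul_mem _ _ ?_
    have : koszulRel 𝕜 c v = koszulRel 𝕜 c (v - a v • c) := by
      rw [← sub_add_cancel v (a v • c), koszulRel_add_right, koszulRel_smul_self, add_zero,
        sub_add_cancel]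
    rw [this]
    exact koszulRel_mem_koszulSub' (by simp [hc]) c

theorem delta₂_mem_range {K : Submodule 𝕜 (⋀[𝕜]^2 V)} {κ : ⋀[𝕜]^2 V} (hκ : κ ∈ K) :
    delta₂ 𝕜 V (1 ⊗ₜ κ) ∈ LinearMap.range (delta₂On K) :=
  ⟨1 ⊗ₜ ⟨κ, hκ⟩, by simp [delta₂On]⟩

theorem range_delta₂On_le {K : Submodule 𝕜 (⋀[𝕜]^2 V)}
    {P : Submodule (Sym 𝕜 V) (Sym 𝕜 V ⊗[𝕜] V)}
    (h : ∀ κ ∈ K, delta₂ 𝕜 V (1 ⊗ₜ κ) ∈ P) : LinearMap.range (delta₂On K) ≤ P := by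
  rintro _ ⟨x, rfl⟩
  induction x with
  | zero => simp
  | add x y hx hy => rw [map_add]; exact add_mem hx hy
  | tmul s κ =>
    have : s ⊗ₜ[𝕜] κ = s • (1 ⊗ₜ[𝕜] κ) := by simp [TensorProduct.smul_tmul']
    rw [this, map_smul]
    refine Submodule.smul_mem _ _ ?_
    simpa [delta₂On] using h κ κ.2

/-- Nakayama at the point `a`, with maximal ideal `I`. Let `N` be the image of `koszulSub L` modulo
boundaries. By `hL`, `N` is generated by the relations between two elements of `L`, and these lie in
`I • N`. Hence some `r ≡ 1` modulo `I` kills `N`. -/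
theorem exists_smul_koszulSub_le [FiniteDimensional 𝕜 V] {K : Submodule 𝕜 (⋀[𝕜]^2 V)}
    {L : Submodule 𝕜 V} (hL : ∀ l ∈ L, ∀ v, wedge l v ∈ K ⊔ wedgeSub L)
    {a : Module.Dual 𝕜 V} (haL : ∀ l ∈ L, a l = 0) {c : V} (hc : a c = 1) :
    ∃ r : Sym 𝕜 V, symEval a r = 1 ∧
      ∀ x ∈ koszulSub L, r • x ∈ LinearMap.range (delta₂On K) := by
  set B := LinearMap.range (delta₂On K) with hB
  set I : Ideal (Sym 𝕜 V) := RingHom.ker (symEval a) with hI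
  set N := (koszulSub L).map B.mkQ with hN
  have hI' : ∀ l ∈ L, symι 𝕜 V l ∈ I := fun l hl => by
    rw [hI, RingHom.mem_ker, symEval_symι, haL l hl]
  have hcI : 1 - symι 𝕜 V c ∈ I := by
    rw [hI, RingHom.mem_ker, map_sub, map_one, symEval_symι, hc, sub_self]
  have key : ∀ l ∈ L, ∀ l' ∈ L, B.mkQ (koszulRel 𝕜 l l') ∈ I • N := by
    intro l hl l' hl'
    -- Since `c` is `1` modulo `I`, the relation may be multiplied by `c`; the Koszul identity then
    -- produces the coefficients `l, l' ∈ I`.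
    have h1 : koszulRel 𝕜 l l' = (1 - symι 𝕜 V c) • koszulRel 𝕜 l l' +
        (symι 𝕜 V l • koszulRel 𝕜 c l' - symι 𝕜 V l' • koszulRel 𝕜 c l) := by
      rw [← smul_koszulRel, ← add_smul, sub_add_cancel, one_smul]
    rw [h1, map_add, map_sub, map_smul, map_smul, map_smul]
    refine add_mem (Submodule.smul_mem_smul hcI ?_) (sub_mem
      (Submodule.smul_mem_smul (hI' l hl) ?_) (Submodule.smul_mem_smul (hI' l' hl') ?_))
    · exact Submodule.mem_map_of_mem (koszulRel_mem_koszulSub hl l')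
    · exact Submodule.mem_map_of_mem (koszulRel_mem_koszulSub' hl' c)
    · exact Submodule.mem_map_of_mem (koszulRel_mem_koszulSub' hl c)
  have hle : N ≤ I • N := by
    rw [hN, koszulSub, Submodule.map_span_le]
    rintro _ ⟨l, hl, v, rfl⟩
    obtain ⟨κ, hκ, η, hη, e⟩ := Submodule.mem_sup.1 (hL l hl v)
    have h0 : B.mkQ (koszulRel 𝕜 l v) = B.mkQ (delta₂ 𝕜 V (1 ⊗ₜ η)) := by
      rw [← delta₂_wedge, ← e, TensorProduct.tmul_add, map_add, map_add]
      have : B.mkQ (delta₂ 𝕜 V (1 ⊗ₜ κ)) = 0 :=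
        (Submodule.Quotient.mk_eq_zero _).2 (delta₂_mem_range hκ)
      rw [this, zero_add]
    rw [h0]
    clear h0 e
    induction hη using Submodule.span_induction with
    | mem x h =>
      obtain ⟨l, hl, l', hl', rfl⟩ := h
      rw [delta₂_wedge]
      exact key l hl l' hl'
    | zero => simp
    | add x y _ _ hx hy =>
      rw [TensorProduct.tmul_add, map_add, map_add]
      exact add_mem hx hy
    | smul t x _ hx =>
      have : (1 : Sym 𝕜 V) ⊗ₜ[𝕜] (t • x) = algebraMap 𝕜 (Sym 𝕜 V) t • (1 ⊗ₜ[𝕜] x) := by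
        rw [algebraMap_smul, TensorProduct.tmul_smul]
      rw [this, map_smul, map_smul]
      exact Submodule.smul_mem _ _ hx
  obtain ⟨r, hr, h⟩ := Submodule.exists_sub_one_mem_and_smul_eq_zero_of_fg_of_le_smul I N
    (IsNoetherian.noetherian N) hle
  refine ⟨r, ?_, fun x hx => ?_⟩
  · rw [hI, RingHom.mem_ker, map_sub, map_one, sub_eq_zero] at hr
    exact hr
  · have := h _ (Submodule.mem_map_of_mem hx)
    rwa [← map_smul, Submodule.mkQ_apply, Submodule.Quotient.mk_eq_zero] at this

/-! ### Functoriality -/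

/-- The map `V ⊗ Sym V → W ⊗ Sym W` induced by a linear map. -/
noncomputable def tensorMap (f : V →ₗ[𝕜] W) :
    Sym 𝕜 V ⊗[𝕜] V →ₛₗ[(symMap f : Sym 𝕜 V →+* Sym 𝕜 W)] Sym 𝕜 W ⊗[𝕜] W where
  toFun := TensorProduct.map (symMap f).toLinearMap f
  map_add' := map_add _
  map_smul' s x := by
    induction x with
    | zero => simp
    | add x y hx hy => rw [smul_add, map_add, hx, hy, map_add, smul_add]
    | tmul t v => simp [TensorProduct.smul_tmul']

@[simp]
theorem tensorMap_tmul (f : V →ₗ[𝕜] W) (s : Sym 𝕜 V) (v : V) :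
    tensorMap f (s ⊗ₜ v) = symMap f s ⊗ₜ f v := rfl

theorem tensorMap_smul (f : V →ₗ[𝕜] W) (s : Sym 𝕜 V) (x : Sym 𝕜 V ⊗[𝕜] V) :
    tensorMap f (s • x) = symMap f s • tensorMap f x :=
  (tensorMap f).map_smulₛₗ s x

theorem tensorMap_tensorMap {X : Type*} [AddCommGroup X] [Module 𝕜 X] (g : W →ₗ[𝕜] X)
    (f : V →ₗ[𝕜] W) (x : Sym 𝕜 V ⊗[𝕜] V) :
    tensorMap g (tensorMap f x) = tensorMap (g ∘ₗ f) x := by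
  induction x with
  | zero => simp
  | add x y hx hy => rw [map_add, map_add, hx, hy, map_add]
  | tmul s v => simp [symMap_symMap]

theorem tensorMap_id (x : Sym 𝕜 V ⊗[𝕜] V) : tensorMap LinearMap.id x = x := by
  induction x with
  | zero => simp
  | add x y hx hy => rw [map_add, hx, hy]
  | tmul s v => simp [symMap_id]

theorem tensorMap_surjective {f : V →ₗ[𝕜] W} (hf : Function.Surjective f) :
    Function.Surjective (tensorMap f) := by
  obtain ⟨g, hg⟩ := f.exists_rightInverse_of_surjective (LinearMap.range_eq_top.2 hf)
  intro x
  exact ⟨tensorMap g x, by rw [tensorMap_tensorMap, hg, tensorMap_id]⟩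

theorem delta₁_tensorMap (f : V →ₗ[𝕜] W) (x : Sym 𝕜 V ⊗[𝕜] V) :
    delta₁ 𝕜 W (tensorMap f x) = symMap f (delta₁ 𝕜 V x) := by
  induction x with
  | zero => simp
  | add x y hx hy => simp only [map_add, hx, hy]
  | tmul s v => simp [delta₁_tmul]

theorem tensorMap_homotopy (f : V →ₗ[𝕜] W) (c : V) (x : Sym 𝕜 V ⊗[𝕜] V) :
    tensorMap f (homotopy c x) = homotopy (f c) (tensorMap f x) := by
  simp only [homotopy_apply, map_sub, tensorMap_smul, symMap_symι, tensorMap_tmul,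
    delta₁_tensorMap]

/-- Choose a linear section `g` of `f`. Every `x` is congruent to its image under `g ∘ f` modulo the
right-hand side, and that image is zero here. -/
theorem mem_of_tensorMap_eq_zero {f : V →ₗ[𝕜] W} (hf : Function.Surjective f)
    {x : Sym 𝕜 V ⊗[𝕜] V} (hx : tensorMap f x = 0) :
    x ∈ Ideal.span (symι 𝕜 V '' (LinearMap.ker f)) •
        (⊤ : Submodule (Sym 𝕜 V) (Sym 𝕜 V ⊗[𝕜] V)) ⊔
      Submodule.span _ {y | ∃ l ∈ LinearMap.ker f, y = 1 ⊗ₜ l} := by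
  obtain ⟨g, hg⟩ := f.exists_rightInverse_of_surjective (LinearMap.range_eq_top.2 hf)
  have hp : ∀ v, v - (g ∘ₗ f) v ∈ LinearMap.ker f := fun v => by
    have : f (g (f v)) = f v := DFunLike.congr_fun hg (f v)
    simp [this]
  suffices h : ∀ x, x - tensorMap (g ∘ₗ f) x ∈
      Ideal.span (symι 𝕜 V '' (LinearMap.ker f)) •
        (⊤ : Submodule (Sym 𝕜 V) (Sym 𝕜 V ⊗[𝕜] V)) ⊔
      Submodule.span _ {y | ∃ l ∈ LinearMap.ker f, y = 1 ⊗ₜ l} by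
    have := h x
    rwa [← tensorMap_tensorMap, hx, map_zero, sub_zero] at this
  intro x
  induction x with
  | zero => simp
  | add x y hx hy => rw [map_add, add_sub_add_comm]; exact add_mem hx hy
  | tmul s v =>
    have e : s ⊗ₜ[𝕜] v - tensorMap (g ∘ₗ f) (s ⊗ₜ v) = (s - symMap (g ∘ₗ f) s) • (1 ⊗ₜ[𝕜] v) +
        symMap (g ∘ₗ f) s • (1 ⊗ₜ[𝕜] (v - (g ∘ₗ f) v)) := by
      simp only [tensorMap_tmul, smul_sub, TensorProduct.smul_tmul', smul_eq_mul, mul_one,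
        TensorProduct.tmul_sub, TensorProduct.sub_tmul]
      abel
    rw [e]
    exact Submodule.add_mem_sup
      (Submodule.smul_mem_smul (sub_symMap_mem hp s) trivial)
      (Submodule.smul_mem _ _ (Submodule.subset_span ⟨_, hp v, rfl⟩))

end KoszulRelations

/-! ### Restriction of boundaries to isotropic subspaces -/

section Support

variable {𝕜 : Type u} [Field 𝕜] {V : Type v} [AddCommGroup V] [Module 𝕜 V]
  {W : Type*} [AddCommGroup W] [Module 𝕜 W]

/-- In a basis of the quotient, the coefficients of the image of `κ` are its pairings with `β_i ∧
β_j`, where the `β_i` are the coordinate functionals pulled back to `V`. These lie in `U`, so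
isotropy kills every coefficient. -/
theorem tensorMap_delta₂_of_isIsotropic [FiniteDimensional 𝕜 V] {K : Submodule 𝕜 (⋀[𝕜]^2 V)}
    {U : Submodule 𝕜 (Module.Dual 𝕜 V)} (h : IsIsotropic K U) {κ : ⋀[𝕜]^2 V} (hκ : κ ∈ K) :
    tensorMap U.dualCoannihilator.mkQ (delta₂ 𝕜 V (1 ⊗ₜ κ)) = 0 := by
  set f := U.dualCoannihilator.mkQ with hf
  set b := Module.finBasis 𝕜 (V ⧸ U.dualCoannihilator) with hb
  have hU : ∀ i, b.coord i ∘ₗ f ∈ U := fun i => by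
    refine Subspace.dualCoannihilator_dualAnnihilator_eq.le
      ((Submodule.mem_dualAnnihilator _).2 fun l hl => ?_)
    rw [LinearMap.comp_apply, hf, Submodule.mkQ_apply, (Submodule.Quotient.mk_eq_zero _).2 hl,
      map_zero]
  let B : (V ⧸ U.dualCoannihilator) →ₗ[𝕜] (V ⧸ U.dualCoannihilator) →ₗ[𝕜]
      Sym 𝕜 (V ⧸ U.dualCoannihilator) ⊗[𝕜] (V ⧸ U.dualCoannihilator) :=
    TensorProduct.mk 𝕜 _ _ ∘ₗ symι 𝕜 _
  let g : ⋀[𝕜]^2 V →ₗ[𝕜] Sym 𝕜 (V ⧸ U.dualCoannihilator) ⊗[𝕜] (V ⧸ U.dualCoannihilator) :=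
    TensorProduct.map (symMap f).toLinearMap f ∘ₗ (delta₂ 𝕜 V).restrictScalars 𝕜 ∘ₗ
      TensorProduct.mk 𝕜 _ _ 1
  have hg : g = ∑ i, ∑ j, (exteriorPower.pairingDual 𝕜 V 2
      (wedge (b.coord i ∘ₗ f) (b.coord j ∘ₗ f))).smulRight (B (b i) (b j)) := by
    apply hom_ext_wedge
    intro v w
    have h1 : g (wedge v w) = B (f v) (f w) - B (f w) (f v) := by
      change tensorMap f (delta₂ 𝕜 V (1 ⊗ₜ wedge v w)) = _
      rw [delta₂_wedge, koszulRel, map_sub, tensorMap_tmul, tensorMap_tmul, symMap_symι,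
        symMap_symι]
      rfl
    rw [h1, ← bilin_sum_coord B (f v) (f w), ← bilin_sum_coord B (f w) (f v)]
    simp only [LinearMap.sum_apply, LinearMap.smulRight_apply, pairingDual_wedge, sub_smul,
      Finset.sum_sub_distrib, LinearMap.comp_apply]
    rfl
  have : g κ = 0 := by
    rw [hg]
    simp only [LinearMap.sum_apply, LinearMap.smulRight_apply]
    refine Finset.sum_eq_zero fun i _ => Finset.sum_eq_zero fun j _ => ?_
    rw [mem_perp.1 (h (wedge_mem_wedgeTwo (hU i) (hU j))) κ hκ, zero_smul]
  exact this

/-! ### Modules supported at the origin -/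

theorem eq_symEval (φ : Sym 𝕜 V →ₐ[𝕜] 𝕜) : φ = symEval (φ.toLinearMap ∘ₗ symι 𝕜 V) :=
  symHom_ext fun v => by simp [symEval_symι]

/-- Nullstellensatz: the radical is the intersection of the maximal ideals above `J`, each of which
is the kernel of evaluation at a point. By hypothesis only the origin can occur, and linear forms
vanish there. -/
theorem symι_mem_radical [IsAlgClosed 𝕜] [FiniteDimensional 𝕜 V] {J : Ideal (Sym 𝕜 V)}
    (h : ∀ a : Module.Dual 𝕜 V, a ≠ 0 → ∃ f ∈ J, symEval a f ≠ 0) (v : V) :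
    symι 𝕜 V v ∈ J.radical := by
  have : IsJacobsonRing (Sym 𝕜 V) := isJacobsonRing_of_finiteType (A := 𝕜)
  rw [← IsJacobsonRing.out' _ (Ideal.radical_isRadical J), Ideal.jacobson, Ideal.mem_sInf]
  rintro m ⟨hJm, hm⟩
  let _ := Ideal.Quotient.field m
  have : Module.Finite 𝕜 (Sym 𝕜 V ⧸ m) := finite_of_finite_type_of_isJacobsonRing 𝕜 _
  let e : 𝕜 ≃ₐ[𝕜] Sym 𝕜 V ⧸ m :=
    AlgEquiv.ofBijective (Algebra.ofId 𝕜 _) IsAlgClosed.algebraMap_bijective_of_isIntegral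
  let φ : Sym 𝕜 V →ₐ[𝕜] 𝕜 := (e.symm : (Sym 𝕜 V ⧸ m) →ₐ[𝕜] 𝕜).comp (Ideal.Quotient.mkₐ 𝕜 m)
  have hφ : ∀ s, φ s = 0 ↔ s ∈ m := fun s => by
    simp only [φ, AlgHom.comp_apply, AlgEquiv.coe_toAlgHom, EmbeddingLike.map_eq_zero_iff]
    exact Ideal.Quotient.eq_zero_iff_mem
  by_cases ha : φ.toLinearMap ∘ₗ symι 𝕜 V = 0
  · exact (hφ _).1 (DFunLike.congr_fun ha v)
  · obtain ⟨f, hf, hne⟩ := h _ ha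
    rw [← eq_symEval] at hne
    exact absurd ((hφ f).2 (hJm (Ideal.le_radical hf))) hne

theorem symInduction {motive : Sym 𝕜 V → Prop}
    (algebraMap : ∀ r, motive (algebraMap 𝕜 (Sym 𝕜 V) r)) (ι : ∀ x, motive (symι 𝕜 V x))
    (mul : ∀ a b, motive a → motive b → motive (a * b))
    (add : ∀ a b, motive a → motive b → motive (a + b)) (a : Sym 𝕜 V) : motive a :=
  SymmetricAlgebra.induction (R := 𝕜) (M := V) algebraMap ι mul add a

/-- Modulo the annihilator all linear forms are nilpotent, so the quotient ring is integral and of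
finite type over `𝕜`, hence finite; `M` is finite over that ring. -/
theorem finiteDimensional_of_support [IsAlgClosed 𝕜] [FiniteDimensional 𝕜 V] (M : Type*)
    [AddCommGroup M] [Module (Sym 𝕜 V) M] [Module 𝕜 M] [IsScalarTower 𝕜 (Sym 𝕜 V) M]
    [Module.Finite (Sym 𝕜 V) M]
    (h : ∀ a : Module.Dual 𝕜 V, a ≠ 0 → ∃ f, symEval a f ≠ 0 ∧ ∀ m : M, f • m = 0) :
    FiniteDimensional 𝕜 M := by
  set J := Module.annihilator (Sym 𝕜 V) M with hJ
  have hrad : ∀ v, symι 𝕜 V v ∈ J.radical := symι_mem_radical fun a ha => by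
    obtain ⟨f, hf, hm⟩ := h a ha
    exact ⟨f, Module.mem_annihilator.2 hm, hf⟩
  have hint : ∀ s : Sym 𝕜 V, IsIntegral 𝕜 (Ideal.Quotient.mk J s) := by
    intro s
    induction s using symInduction with
    | algebraMap r => exact isIntegral_algebraMap (x := r) (A := Sym 𝕜 V ⧸ J)
    | ι v =>
      obtain ⟨n, hn⟩ := hrad v
      refine IsIntegral.of_pow (n := n + 1) n.succ_pos ?_
      rw [← map_pow, pow_succ, map_mul, Ideal.Quotient.eq_zero_iff_mem.2 hn, zero_mul]
      exact isIntegral_zero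
    | mul a b ha hb => rw [map_mul]; exact ha.mul hb
    | add a b ha hb => rw [map_add]; exact ha.add hb
  have : Algebra.IsIntegral 𝕜 (Sym 𝕜 V ⧸ J) := ⟨fun x => by
    obtain ⟨s, rfl⟩ := Ideal.Quotient.mk_surjective x
    exact hint s⟩
  have : Module.Finite 𝕜 (Sym 𝕜 V ⧸ J) := Algebra.IsIntegral.finite
  have htor := Module.isTorsionBySet_annihilator (R := Sym 𝕜 V) (M := M)
  let _ : Module (Sym 𝕜 V ⧸ J) M := htor.module
  have : IsScalarTower (Sym 𝕜 V) (Sym 𝕜 V ⧸ J) M := htor.isScalarTower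
  have : IsScalarTower 𝕜 (Sym 𝕜 V ⧸ J) M := htor.isScalarTower
  have : Module.Finite (Sym 𝕜 V ⧸ J) M := Module.Finite.of_restrictScalars_finite (Sym 𝕜 V) _ _
  exact Module.Finite.trans (Sym 𝕜 V ⧸ J) M

/-! ### The grading -/

theorem symMap_smul_id {q : ℕ} {s : Sym 𝕜 V} (hs : s ∈ symPow 𝕜 V q) (t : 𝕜) :
    symMap (t • LinearMap.id) s = t ^ q • s := by
  induction hs using Submodule.pow_induction_on_left' with
  | algebraMap r => simp
  | add x y i hx hy h h' => rw [map_add, h, h', smul_add]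
  | mem_mul m hm i x hx h =>
    obtain ⟨v, rfl⟩ := hm
    rw [map_mul, h, symMap_symι, LinearMap.smul_apply, LinearMap.id_apply, map_smul,
      smul_mul_smul_comm, pow_succ']

/-- The factor `V` is scaled too, whence the exponent `q + 1`. Degrees thereby become eigenvalues of
the scaling. -/
theorem tensorMap_smul_id {q : ℕ} {x : Sym 𝕜 V ⊗[𝕜] V} (hx : x ∈ tensorSymPow 𝕜 V q) (t : 𝕜) :
    tensorMap (t • LinearMap.id) x = t ^ (q + 1) • x := by
  obtain ⟨y, rfl⟩ := hx
  induction y with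
  | zero => simp
  | add x y hx hy => rw [map_add, map_add, hx, hy, smul_add]
  | tmul s v =>
    rw [LinearMap.rTensor_tmul, tensorMap_tmul, Submodule.subtype_apply, symMap_smul_id s.2,
      LinearMap.smul_apply, LinearMap.id_apply, TensorProduct.tmul_smul,
      ← TensorProduct.smul_tmul', smul_smul, pow_succ']

theorem symMap_mem_symPow (f : V →ₗ[𝕜] W) {q : ℕ} {s : Sym 𝕜 V} (hs : s ∈ symPow 𝕜 V q) :
    symMap f s ∈ symPow 𝕜 W q := by
  have : (symPow 𝕜 V q).map (symMap f).toLinearMap ≤ symPow 𝕜 W q := by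
    rw [symPow, symPow, Submodule.map_pow]
    refine pow_le_pow_left' ?_ q
    rintro _ ⟨_, ⟨v, rfl⟩, rfl⟩
    exact ⟨f v, (symMap_symι f v).symm⟩
  exact this ⟨s, hs, rfl⟩

theorem tmul_mem_tensorSymPow {q : ℕ} {s : Sym 𝕜 V} (hs : s ∈ symPow 𝕜 V q) (v : V) :
    s ⊗ₜ v ∈ tensorSymPow 𝕜 V q :=
  ⟨⟨s, hs⟩ ⊗ₜ v, rfl⟩

theorem tensorMap_mem_tensorSymPow (f : V →ₗ[𝕜] W) {q : ℕ} {x : Sym 𝕜 V ⊗[𝕜] V}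
    (hx : x ∈ tensorSymPow 𝕜 V q) : tensorMap f x ∈ tensorSymPow 𝕜 W q := by
  obtain ⟨y, rfl⟩ := hx
  induction y with
  | zero => simp
  | add x y hx hy => rw [map_add, map_add]; exact add_mem hx hy
  | tmul s v => exact tmul_mem_tensorSymPow (symMap_mem_symPow f s.2) (f v)

theorem delta₁_mem_symPow {q : ℕ} {x : Sym 𝕜 V ⊗[𝕜] V} (hx : x ∈ tensorSymPow 𝕜 V q) :
    delta₁ 𝕜 V x ∈ symPow 𝕜 V (q + 1) := by
  obtain ⟨y, rfl⟩ := hx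
  induction y with
  | zero => simp
  | add x y hx hy => rw [map_add, map_add]; exact add_mem hx hy
  | tmul s v =>
    rw [LinearMap.rTensor_tmul, delta₁_tmul, symPow, pow_succ]
    exact Submodule.mul_mem_mul s.2 ⟨v, rfl⟩

theorem iSup_symPow : ⨆ q, symPow 𝕜 V q = ⊤ := by
  rw [eq_top_iff]
  rintro s -
  induction s using symInduction with
  | algebraMap r =>
    refine Submodule.mem_iSup_of_mem 0 ?_
    rw [symPow, pow_zero]
    exact Submodule.algebraMap_mem r
  | ι v =>
    refine Submodule.mem_iSup_of_mem 1 ?_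
    rw [symPow, pow_one]
    exact ⟨v, rfl⟩
  | mul a b ha hb =>
    have h : (⨆ q, symPow 𝕜 V q) * (⨆ q, symPow 𝕜 V q) ≤ ⨆ q, symPow 𝕜 V q := by
      rw [Submodule.iSup_mul]
      refine iSup_le fun i => ?_
      rw [Submodule.mul_iSup]
      refine iSup_le fun j => ?_
      rw [symPow, symPow, ← pow_add]
      exact le_iSup (fun q => symPow 𝕜 V q) (i + j)
    exact h (Submodule.mul_mem_mul ha hb)
  | add a b ha hb => exact add_mem ha hb

theorem iSup_tensorSymPow : ⨆ q, tensorSymPow 𝕜 V q = ⊤ := by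
  rw [eq_top_iff]
  rintro x -
  induction x with
  | zero => exact zero_mem _
  | add x y hx hy => exact add_mem hx hy
  | tmul s v =>
    have hs : s ∈ ⨆ q, symPow 𝕜 V q := by rw [iSup_symPow]; trivial
    have : ⨆ q, symPow 𝕜 V q ≤
        (⨆ q, tensorSymPow 𝕜 V q).comap ((TensorProduct.mk 𝕜 _ _).flip v) :=
      iSup_le fun q s hs => Submodule.mem_iSup_of_mem q (tmul_mem_tensorSymPow hs v)
    exact this hs

/-- Eigenspaces for distinct eigenvalues are independent, so if the total is an eigenvector for `μ
j`, the other components must contribute zero. -/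
theorem map_component_eq {F X : Type*} [AddCommGroup F] [Module 𝕜 F] [AddCommGroup X] [Module 𝕜 X]
    (g : F →ₗ[𝕜] X) (T : Module.End 𝕜 X) {μ : ℕ → 𝕜} (hμ : Function.Injective μ) (z : ℕ →₀ F)
    (hz : ∀ i, T (g (z i)) = μ i • g (z i)) {j : ℕ}
    (hj : T (g (z.sum fun _ => id)) = μ j • g (z.sum fun _ => id)) :
    g (z j) = g (z.sum fun _ => id) := by
  classical
  have hind := T.eigenspaces_iSupIndep.comp hμ
  have hsum : g (z.sum fun _ => id) = g (z j) + ∑ i ∈ z.support.erase j, g (z i) := by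
    rw [Finsupp.sum, map_sum]
    by_cases h : j ∈ z.support
    · rw [Finset.add_sum_erase z.support (fun i => g (z i)) h]; rfl
    · rw [Finset.erase_eq_of_notMem h, Finsupp.notMem_support_iff.1 h, map_zero, zero_add]; rfl
  have h1 : g (z.sum fun _ => id) - g (z j) ∈ T.eigenspace (μ j) :=
    sub_mem (Module.End.mem_eigenspace_iff.2 hj) (Module.End.mem_eigenspace_iff.2 (hz j))
  have h2 : g (z.sum fun _ => id) - g (z j) ∈ ⨆ i, ⨆ (_ : i ≠ j), T.eigenspace (μ i) := by
    rw [hsum, add_sub_cancel_left]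
    refine sum_mem fun i hi => ?_
    exact Submodule.mem_iSup_of_mem i (Submodule.mem_iSup_of_mem (Finset.ne_of_mem_erase hi)
      (Module.End.mem_eigenspace_iff.2 (hz i)))
  have := Submodule.disjoint_def.1 (hind j) _ h1 h2
  exact (sub_eq_zero.1 this).symm

theorem exists_forall_eigenvector_eq_zero {X : Type*} [AddCommGroup X] [Module 𝕜 X]
    (T : Module.End 𝕜 X) {μ : ℕ → 𝕜} (hμ : Function.Injective μ) (Q : Submodule 𝕜 X)
    [FiniteDimensional 𝕜 Q] :
    ∃ q₀, ∀ q, q₀ ≤ q → ∀ x ∈ Q, T x = μ q • x → x = 0 := by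
  let A : Set ℕ := {q | ∃ x ∈ Q, x ≠ 0 ∧ T x = μ q • x}
  have hA : A.Finite := by
    choose x hxQ hx0 hxT using fun q : A => q.2
    have hli : LinearIndependent 𝕜 x := Module.End.eigenvectors_linearIndependent' T
      (fun q : A => μ q) (hμ.comp Subtype.coe_injective) x
      fun q => ⟨Module.End.mem_eigenspace_iff.2 (hxT q), hx0 q⟩
    have hli' : LinearIndependent 𝕜 (fun q => (⟨x q, hxQ q⟩ : Q)) :=
      LinearIndependent.of_comp Q.subtype hli
    exact Set.finite_coe_iff.1 hli'.finite_of_isNoetherian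
  obtain ⟨N, hN⟩ := hA.bddAbove
  refine ⟨N + 1, fun q hq x hx hT => ?_⟩
  by_contra h0
  exact absurd (hN ⟨x, hx, h0, hT⟩) (by omega)

theorem two_pow_succ_injective [CharZero 𝕜] : Function.Injective fun q : ℕ => (2 : 𝕜) ^ (q + 1) := by
  intro a b h
  have h' : ((2 ^ (a + 1) : ℕ) : 𝕜) = (2 ^ (b + 1) : ℕ) := by push_cast; exact h
  have := Nat.pow_right_injective le_rfl (Nat.cast_injective h')
  omega

/-- The endomorphism of `(V ⊗ Sym V) / B` induced by multiplication by `2` on `V`. -/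
noncomputable def scaleQuot (B : Submodule (Sym 𝕜 V) (Sym 𝕜 V ⊗[𝕜] V))
    (hB : ∀ x ∈ B, tensorMap ((2 : 𝕜) • LinearMap.id) x ∈ B) :
    Module.End 𝕜 ((Sym 𝕜 V ⊗[𝕜] V) ⧸ B) where
  toFun := B.mapQ B (tensorMap ((2 : 𝕜) • LinearMap.id)) hB
  map_add' := map_add _
  map_smul' t x := by
    rw [← algebraMap_smul (Sym 𝕜 V) t x, LinearMap.map_smulₛₗ]
    simp

/-- The image of `A` modulo `B` is finite-dimensional, while classes of degree `q` are eigenvectors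
of the scaling with eigenvalue `2 ^ (q + 1)`; only finitely many of these occur. Stability of `B`
under scaling stands in for homogeneity. -/
theorem exists_forall_mem_of_support [IsAlgClosed 𝕜] [CharZero 𝕜] [FiniteDimensional 𝕜 V]
    (A B : Submodule (Sym 𝕜 V) (Sym 𝕜 V ⊗[𝕜] V))
    (hB : ∀ x ∈ B, tensorMap ((2 : 𝕜) • LinearMap.id) x ∈ B)
    (h : ∀ a : Module.Dual 𝕜 V, a ≠ 0 → ∃ f, symEval a f ≠ 0 ∧ ∀ x ∈ A, f • x ∈ B) :
    ∃ q₀, ∀ q, q₀ ≤ q → ∀ x ∈ A, x ∈ tensorSymPow 𝕜 V q → x ∈ B := by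
  have : Module.Finite (Sym 𝕜 V) ((A.map B.mkQ).restrictScalars 𝕜) :=
    inferInstanceAs (Module.Finite (Sym 𝕜 V) (A.map B.mkQ))
  have : FiniteDimensional 𝕜 ((A.map B.mkQ).restrictScalars 𝕜) :=
    finiteDimensional_of_support (V := V) ((A.map B.mkQ).restrictScalars 𝕜) fun a ha => by
      obtain ⟨f, hf, hx⟩ := h a ha
      refine ⟨f, hf, ?_⟩
      rintro ⟨_, x, hxA, rfl⟩
      refine Subtype.ext ?_
      change f • B.mkQ x = 0
      rw [← map_smul]
      exact (Submodule.Quotient.mk_eq_zero _).2 (hx x hxA)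
  obtain ⟨q₀, hq₀⟩ := exists_forall_eigenvector_eq_zero (scaleQuot B hB)
    two_pow_succ_injective ((A.map B.mkQ).restrictScalars 𝕜)
  refine ⟨q₀, fun q hq x hxA hx => (Submodule.Quotient.mk_eq_zero B).1 ?_⟩
  refine hq₀ q hq _ ⟨x, hxA, rfl⟩ ?_
  change B.mkQ (tensorMap _ x) = _
  rw [tensorMap_smul_id hx]
  rfl

/-! ### Dimensions -/

theorem finrank_homogeneousSubmodule (ι : Type*) [Fintype ι] (q : ℕ) :
    Module.Finite 𝕜 (MvPolynomial.homogeneousSubmodule ι 𝕜 q) ∧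
    Module.finrank 𝕜 (MvPolynomial.homogeneousSubmodule ι 𝕜 q) =
      (Fintype.card ι).multichoose q := by
  classical
  let e : {d : ι →₀ ℕ | d.degree = q} ≃ _root_.Sym ι q := (_root_.Sym.equivNatSum ι q).symm
  let _ : Fintype {d : ι →₀ ℕ | d.degree = q} := Fintype.ofEquiv _ e.symm
  rw [MvPolynomial.homogeneousSubmodule_eq_finsupp_supported]
  let E := AddMonoidAlgebra.supportedEquivFinsupp (R := 𝕜) (S := 𝕜) {d : ι →₀ ℕ | d.degree = q}
  refine ⟨Module.Finite.equiv E.symm, ?_⟩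
  rw [LinearEquiv.finrank_eq E, Module.finrank_finsupp_self, Fintype.card_congr e,
    Sym.card_sym_eq_multichoose]

theorem finrank_symPow [FiniteDimensional 𝕜 V] (q : ℕ) :
    Module.Finite 𝕜 (symPow 𝕜 V q) ∧
    Module.finrank 𝕜 (symPow 𝕜 V q) = (Module.finrank 𝕜 V).multichoose q := by
  set b := Module.finBasis 𝕜 V with hb
  have h : (symPow 𝕜 V q).map (symEquiv b).toAlgHom.toLinearMap =
      MvPolynomial.homogeneousSubmodule _ 𝕜 q := by
    rw [symPow, Submodule.map_pow, ← MvPolynomial.homogeneousSubmodule_one_pow,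
      MvPolynomial.homogeneousSubmodule_one_eq_span_X, LinearMap.range_eq_map, ← b.span_eq,
      Submodule.map_span, Submodule.map_span, ← Set.range_comp, ← Set.range_comp]
    congr 3
    ext i : 1
    exact symEquiv_symι b i
  let e := (symEquiv b).toLinearEquiv.submoduleMap (symPow 𝕜 V q)
  have h2 : (symPow 𝕜 V q).map
      ((symEquiv b).toLinearEquiv : Sym 𝕜 V →ₗ[𝕜] MvPolynomial (Fin (Module.finrank 𝕜 V)) 𝕜) =
      MvPolynomial.homogeneousSubmodule (Fin (Module.finrank 𝕜 V)) 𝕜 q := h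
  have h3 := finrank_homogeneousSubmodule (𝕜 := 𝕜) (Fin (Module.finrank 𝕜 V)) q
  rw [← h2, Fintype.card_fin] at h3
  have := h3.1
  exact ⟨Module.Finite.equiv e.symm, by rw [LinearEquiv.finrank_eq e, h3.2]⟩

instance [FiniteDimensional 𝕜 V] (q : ℕ) : FiniteDimensional 𝕜 (symPow 𝕜 V q) :=
  (finrank_symPow q).1

instance [FiniteDimensional 𝕜 V] (q : ℕ) : FiniteDimensional 𝕜 (tensorSymPow 𝕜 V q) := by
  unfold tensorSymPow
  infer_instance

theorem finrank_tensorSymPow [FiniteDimensional 𝕜 V] (q : ℕ) :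
    Module.finrank 𝕜 (tensorSymPow 𝕜 V q) =
      (Module.finrank 𝕜 V).multichoose q * Module.finrank 𝕜 V := by
  rw [tensorSymPow, LinearMap.finrank_range_of_inj
    (Module.Flat.rTensor_preserves_injective_linearMap _ (Submodule.subtype_injective _)),
    Module.finrank_tensorProduct, (finrank_symPow q).2]

/-- The cycles of degree `q`. -/
noncomputable def cycles (𝕜 : Type u) [Field 𝕜] (V : Type v) [AddCommGroup V] [Module 𝕜 V]
    (q : ℕ) : Submodule 𝕜 (Sym 𝕜 V ⊗[𝕜] V) :=
  (LinearMap.ker (delta₁ 𝕜 V)).restrictScalars 𝕜 ⊓ tensorSymPow 𝕜 V q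

instance [FiniteDimensional 𝕜 V] (q : ℕ) : FiniteDimensional 𝕜 (cycles 𝕜 V q) := by
  unfold cycles
  infer_instance

/-- Rank-nullity for `δ₁`, which maps `V ⊗ Sym^q V` onto `Sym^{q+1} V`. The additive form avoids
truncated subtraction. -/
theorem finrank_cycles_add [FiniteDimensional 𝕜 V] (q : ℕ) :
    Module.finrank 𝕜 (cycles 𝕜 V q) + (Module.finrank 𝕜 V).multichoose (q + 1) =
      (Module.finrank 𝕜 V).multichoose q * Module.finrank 𝕜 V := by
  let d : tensorSymPow 𝕜 V q →ₗ[𝕜] Sym 𝕜 V :=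
    ((delta₁ 𝕜 V).restrictScalars 𝕜).domRestrict (tensorSymPow 𝕜 V q)
  have hr : LinearMap.range d = symPow 𝕜 V (q + 1) := by
    refine le_antisymm ?_ ?_
    · rintro _ ⟨x, rfl⟩
      exact delta₁_mem_symPow x.2
    · rw [symPow, pow_succ, Submodule.mul_le]
      rintro s hs _ ⟨v, rfl⟩
      exact ⟨⟨s ⊗ₜ v, tmul_mem_tensorSymPow hs v⟩, delta₁_tmul s v⟩
  have hk : (LinearMap.ker d).map (tensorSymPow 𝕜 V q).subtype = cycles 𝕜 V q := by
    ext x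
    simp only [Submodule.mem_map, LinearMap.mem_ker, Submodule.subtype_apply, Subtype.exists,
      cycles, Submodule.mem_inf, Submodule.restrictScalars_mem]
    constructor
    · rintro ⟨y, hy, h, rfl⟩
      exact ⟨h, hy⟩
    · rintro ⟨h, hx⟩
      exact ⟨x, hx, h, rfl⟩
  have := LinearMap.finrank_range_add_finrank_ker (K := 𝕜) (V := tensorSymPow 𝕜 V q)
    (V₂ := Sym 𝕜 V) d
  rw [hr, (finrank_symPow (q + 1)).2, finrank_tensorSymPow] at this
  rw [← hk, Submodule.finrank_map_subtype_eq]
  omega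

/-- Pascal's rule combined with `C(N, k+1) (k+1) = C(N, k) (N - k)`, for `N = n + q` and `k = q +
1`, after reindexing. -/
theorem choose_identity (n q : ℕ) :
    (q + 1) * (q + n).choose (q + 2) + n.multichoose (q + 2) = n.multichoose (q + 1) * n := by
  cases n with
  | zero => simp [Nat.choose_eq_zero_of_lt]
  | succ m =>
    have h := Nat.choose_succ_right_eq (m + q + 1) (q + 1)
    rw [show m + q + 1 - (q + 1) = m by omega] at h
    rw [Nat.multichoose_eq, Nat.multichoose_eq, show m + 1 + (q + 2) - 1 = m + q + 1 + 1 by omega,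
      show m + 1 + (q + 1) - 1 = m + q + 1 by omega, show q + (m + 1) = m + q + 1 by omega,
      Nat.choose_succ_succ' (m + q + 1) (q + 1)]
    linarith

theorem finrank_cycles [FiniteDimensional 𝕜 V] (q : ℕ) :
    Module.finrank 𝕜 (cycles 𝕜 V (q + 1)) =
      (q + 1) * (q + Module.finrank 𝕜 V).choose (q + 2) := by
  have h1 := finrank_cycles_add (𝕜 := 𝕜) (V := V) (q + 1)
  rw [show q + 1 + 1 = q + 2 from rfl] at h1
  have h2 := choose_identity (Module.finrank 𝕜 V) q
  omega

end Support

/-! ### Comparison of cycles on `V` with cycles on the quotients -/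

section Main

variable {𝕜 : Type u} [Field 𝕜] {V : Type v} [AddCommGroup V] [Module 𝕜 V]
  {W : Type*} [AddCommGroup W] [Module 𝕜 W]

/-- `tensorMap` as a `𝕜`-linear map. -/
noncomputable def tensorMapₗ (f : V →ₗ[𝕜] W) : Sym 𝕜 V ⊗[𝕜] V →ₗ[𝕜] Sym 𝕜 W ⊗[𝕜] W :=
  TensorProduct.map (symMap f).toLinearMap f

theorem tensorMap_scale_comm (f : V →ₗ[𝕜] W) (t : 𝕜) (x : Sym 𝕜 V ⊗[𝕜] V) :
    tensorMap f (tensorMap (t • LinearMap.id) x) = tensorMap (t • LinearMap.id) (tensorMap f x) := by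
  have h : f ∘ₗ (t • LinearMap.id) = (t • LinearMap.id) ∘ₗ f := by
    ext v
    simp
  rw [tensorMap_tensorMap, tensorMap_tensorMap, h]

theorem delta₂_mem_tensorSymPow (κ : ⋀[𝕜]^2 V) : delta₂ 𝕜 V (1 ⊗ₜ κ) ∈ tensorSymPow 𝕜 V 1 := by
  have h : ⊤ ≤ (tensorSymPow 𝕜 V 1).comap
      ((delta₂ 𝕜 V).restrictScalars 𝕜 ∘ₗ TensorProduct.mk 𝕜 _ _ 1) := by
    rw [← span_wedge, Submodule.span_le]
    rintro _ ⟨v, w, rfl⟩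
    change delta₂ 𝕜 V (1 ⊗ₜ wedge v w) ∈ tensorSymPow 𝕜 V 1
    have hι : ∀ v, symι 𝕜 V v ∈ symPow 𝕜 V 1 := fun v => by
      rw [symPow, pow_one]
      exact ⟨v, rfl⟩
    rw [delta₂_wedge, koszulRel]
    exact sub_mem (tmul_mem_tensorSymPow (hι v) w) (tmul_mem_tensorSymPow (hι w) v)
  exact h trivial

theorem tensorMap_scale_mem_range {K : Submodule 𝕜 (⋀[𝕜]^2 V)} (t : 𝕜) {x : Sym 𝕜 V ⊗[𝕜] V}
    (hx : x ∈ LinearMap.range (delta₂On K)) :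
    tensorMap (t • LinearMap.id) x ∈ LinearMap.range (delta₂On K) := by
  have h : LinearMap.range (delta₂On K) ≤
      (LinearMap.range (delta₂On K)).comap (tensorMap (t • LinearMap.id)) :=
    range_delta₂On_le fun κ hκ => by
      rw [Submodule.mem_comap, tensorMap_smul_id (delta₂_mem_tensorSymPow κ)]
      exact Submodule.smul_of_tower_mem _ _ (delta₂_mem_range hκ)
  exact h hx

theorem mem_iff_forall_dualCoannihilator [FiniteDimensional 𝕜 V]
    {U : Submodule 𝕜 (Module.Dual 𝕜 V)} {a : Module.Dual 𝕜 V} :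
    a ∈ U ↔ ∀ l ∈ U.dualCoannihilator, a l = 0 := by
  rw [← Submodule.mem_dualAnnihilator, Subspace.dualCoannihilator_dualAnnihilator_eq]

theorem finrank_quotient_dualCoannihilator [FiniteDimensional 𝕜 V]
    (U : Submodule 𝕜 (Module.Dual 𝕜 V)) :
    Module.finrank 𝕜 (V ⧸ U.dualCoannihilator) = Module.finrank 𝕜 U := by
  have h1 := Subspace.finrank_add_finrank_dualCoannihilator_eq U
  have h2 := U.dualCoannihilator.finrank_quotient_add_finrank
  omega

/-- The cycles of `V ⊗ Sym V` that vanish on all the subspaces `U t` with `t ∈ s`. -/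
noncomputable def vanishingCycles {ι : Type*} (U : ι → Submodule 𝕜 (Module.Dual 𝕜 V)) (s : Set ι) :
    Submodule (Sym 𝕜 V) (Sym 𝕜 V ⊗[𝕜] V) :=
  LinearMap.ker (delta₁ 𝕜 V) ⊓
    ⨅ t ∈ s, LinearMap.ker (tensorMap (U t).dualCoannihilator.mkQ)

theorem mem_vanishingCycles {ι : Type*} {U : ι → Submodule 𝕜 (Module.Dual 𝕜 V)} {s : Set ι}
    {x : Sym 𝕜 V ⊗[𝕜] V} : x ∈ vanishingCycles U s ↔
      delta₁ 𝕜 V x = 0 ∧ ∀ t ∈ s, tensorMap (U t).dualCoannihilator.mkQ x = 0 := by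
  simp [vanishingCycles]

theorem tensorMap_scale_mem_vanishingCycles {ι : Type*}
    {U : ι → Submodule 𝕜 (Module.Dual 𝕜 V)} {s : Set ι} (t : 𝕜) {x : Sym 𝕜 V ⊗[𝕜] V}
    (hx : x ∈ vanishingCycles U s) : tensorMap (t • LinearMap.id) x ∈ vanishingCycles U s := by
  rw [mem_vanishingCycles] at hx ⊢
  refine ⟨by rw [delta₁_tensorMap, hx.1, map_zero], fun i hi => ?_⟩
  rw [tensorMap_scale_comm, hx.2 i hi, map_zero]

/-- Both `g₁` and the product of the `g₂ t` have the same kernel, so their images are isomorphic. -/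
theorem finrank_range_eq_sum {A X ι : Type*} {Y : ι → Type*} [Fintype ι] [AddCommGroup A]
    [Module 𝕜 A] [AddCommGroup X] [Module 𝕜 X] [∀ t, AddCommGroup (Y t)] [∀ t, Module 𝕜 (Y t)]
    [∀ t, FiniteDimensional 𝕜 (Y t)] (g₁ : A →ₗ[𝕜] X) (g₂ : ∀ t, A →ₗ[𝕜] Y t)
    (hk : ∀ x, g₁ x = 0 ↔ ∀ t, g₂ t x = 0) (hg₂ : ∀ y : ∀ t, Y t, ∃ x, ∀ t, g₂ t x = y t) :
    Module.finrank 𝕜 (LinearMap.range g₁) = ∑ t, Module.finrank 𝕜 (Y t) := by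
  have hker : LinearMap.ker g₁ = LinearMap.ker (LinearMap.pi g₂) := by
    ext x
    simp only [LinearMap.mem_ker, hk, funext_iff]
    rfl
  have hsurj : Function.Surjective (LinearMap.pi g₂) := fun y => by
    obtain ⟨x, hx⟩ := hg₂ y
    exact ⟨x, funext hx⟩
  rw [← Module.finrank_pi_fintype]
  exact (g₁.quotKerEquivRange.symm ≪≫ₗ Submodule.quotEquivOfEq _ _ hker ≪≫ₗ
    (LinearMap.pi g₂).quotKerEquivOfSurjective hsurj).finrank_eq

/-- The restriction of `tensorMap` to cycles. -/
noncomputable def cyclesMap (f : V →ₗ[𝕜] W) (q : ℕ) : cycles 𝕜 V q →ₗ[𝕜] cycles 𝕜 W q :=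
  (tensorMapₗ f).restrict fun x hx =>
    ⟨by
      change delta₁ 𝕜 _ (tensorMap _ x) = 0
      rw [delta₁_tensorMap, show delta₁ 𝕜 V x = 0 from hx.1, map_zero],
      tensorMap_mem_tensorSymPow _ hx.2⟩

theorem coe_cyclesMap_apply (f : V →ₗ[𝕜] W) {q : ℕ} (x : cycles 𝕜 V q) :
    (cyclesMap f q x : Sym 𝕜 W ⊗[𝕜] W) = tensorMap f x := rfl

theorem cyclesMap_eq_zero_iff (f : V →ₗ[𝕜] W) {q : ℕ} (x : cycles 𝕜 V q) :
    cyclesMap f q x = 0 ↔ tensorMap f (x : Sym 𝕜 V ⊗[𝕜] V) = 0 := by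
  rw [← coe_cyclesMap_apply]
  exact Subtype.ext_iff

/-! ### Local statements at a nonzero point -/

section Local

variable [FiniteDimensional 𝕜 V] [CharZero 𝕜] {K : Submodule 𝕜 (⋀[𝕜]^2 V)} {ι : Type*}
  {U : ι → Submodule 𝕜 (Module.Dual 𝕜 V)}

/-- Take `L = (U t)^⊥` if `a` is resonant and lies in `U t`, and `L = ker a` otherwise. In both
cases `c` times a vanishing cycle lies in `koszulSub L`, and the Nakayama factor sends it to a
boundary. -/
theorem exists_smul_vanishingCycles_le (hsep : ∀ t, IsSeparable K (U t))
    (hcover : ∀ a ∈ resonance K, a ≠ 0 → ∃ t, a ∈ U t) {a : Module.Dual 𝕜 V} (ha : a ≠ 0) :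
    ∃ r : Sym 𝕜 V, symEval a r ≠ 0 ∧
      ∀ x ∈ vanishingCycles U Set.univ, r • x ∈ LinearMap.range (delta₂On K) := by
  obtain ⟨c, hc⟩ := exists_eq_one ha
  suffices h : ∃ L : Submodule 𝕜 V, (∀ l ∈ L, ∀ v, wedge l v ∈ K ⊔ wedgeSub L) ∧
      (∀ l ∈ L, a l = 0) ∧ ∀ x ∈ vanishingCycles U Set.univ, homotopy c x ∈ koszulSub L by
    obtain ⟨L, hL, haL, hx⟩ := h
    obtain ⟨r, hr, h⟩ := exists_smul_koszulSub_le hL haL hc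
    refine ⟨r * symι 𝕜 V c, by simp [hr, symEval_symι, hc], fun x hxA => ?_⟩
    rw [mul_smul, ← homotopy_of_mem_ker c (mem_vanishingCycles.1 hxA).1]
    exact h _ (hx x hxA)
  by_cases haR : a ∈ resonance K
  · obtain ⟨t, hat⟩ := hcover a haR ha
    refine ⟨(U t).dualCoannihilator, fun l hl v => (hsep t).wedge_mem hl v,
      mem_iff_forall_dualCoannihilator.1 hat, fun x hx => ?_⟩
    have := mem_of_tensorMap_eq_zero (Submodule.mkQ_surjective _)
      ((mem_vanishingCycles.1 hx).2 t trivial)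
    rw [Submodule.ker_mkQ] at this
    exact homotopy_mem_koszulSub_of_mem c this
  · exact ⟨LinearMap.ker a, fun l _ v => wedge_mem_of_notMem_resonance haR l v,
      fun l hl => hl, fun x _ => homotopy_mem_koszulSub_of_ker hc x⟩

omit [CharZero 𝕜] in
-- A lift `x` of `y` need not be a cycle, but `homotopy c x` is one, and it maps to `c` times `y`.
-- Multiplying by linear forms that vanish on the other `U t` but not at `b` makes it vanish on
-- those subspaces.
theorem exists_smul_mem_map_vanishingCycles [Fintype ι]
    (hdisj : ∀ s t, s ≠ t → ∀ a ≠ 0, a ∈ U s → a ∉ U t) (s : ι)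
    {b : Module.Dual 𝕜 (V ⧸ (U s).dualCoannihilator)} (hb : b ≠ 0) :
    ∃ r, symEval b r ≠ 0 ∧ ∀ y, delta₁ 𝕜 _ y = 0 →
      ∃ z ∈ vanishingCycles U {t | t ≠ s}, tensorMap (U s).dualCoannihilator.mkQ z = r • y := by
  classical
  set f := (U s).dualCoannihilator.mkQ with hf
  have ha : b ∘ₗ f ≠ 0 := fun h => hb <| by
    ext v
    exact DFunLike.congr_fun h v
  have has : b ∘ₗ f ∈ U s := mem_iff_forall_dualCoannihilator.2 fun l hl => by
    rw [LinearMap.comp_apply, hf, Submodule.mkQ_apply, (Submodule.Quotient.mk_eq_zero _).2 hl,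
      map_zero]
  obtain ⟨c, hc⟩ := exists_eq_one ha
  have hl : ∀ t, ∃ l, t ≠ s → l ∈ (U t).dualCoannihilator ∧ (b ∘ₗ f) l ≠ 0 := fun t => by
    by_cases hts : t = s
    -- A dummy value: the product below omits `s`.
    · exact ⟨0, fun h => absurd hts h⟩
    · have := hdisj s t (Ne.symm hts) _ ha has
      rw [mem_iff_forall_dualCoannihilator] at this
      push Not at this
      obtain ⟨l, h⟩ := this
      exact ⟨l, fun _ => h⟩
  choose l hl using hl
  set p := ∏ t ∈ Finset.univ.erase s, symι 𝕜 V (l t) with hp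
  refine ⟨symMap f (p * symι 𝕜 V c), ?_, fun y hy => ?_⟩
  · rw [symEval_symMap, map_mul, symEval_symι, hc, mul_one, hp, map_prod]
    refine Finset.prod_ne_zero_iff.2 fun t ht => ?_
    rw [symEval_symι]
    exact (hl t (Finset.ne_of_mem_erase ht)).2
  · obtain ⟨x, rfl⟩ := tensorMap_surjective (f := f) (Submodule.mkQ_surjective _) y
    refine ⟨p • homotopy c x, mem_vanishingCycles.2 ⟨?_, fun t ht => ?_⟩, ?_⟩
    · rw [map_smul, delta₁_homotopy, smul_zero]
    · have : symMap (U t).dualCoannihilator.mkQ p = 0 := by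
        rw [hp, map_prod]
        refine Finset.prod_eq_zero (Finset.mem_erase.2 ⟨ht, Finset.mem_univ t⟩) ?_
        rw [symMap_symι, Submodule.mkQ_apply, (Submodule.Quotient.mk_eq_zero _).2 (hl t ht).1,
          map_zero]
      rw [tensorMap_smul, this, zero_smul]
    · rw [tensorMap_smul, tensorMap_homotopy, homotopy_of_mem_ker _ hy, map_mul, mul_smul,
        symMap_symι]

omit [FiniteDimensional 𝕜 V] in
theorem tensorMap_component_eq (f : V →ₗ[𝕜] W) {g : ℕ →₀ Sym 𝕜 V ⊗[𝕜] V}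
    (hg : ∀ i, g i ∈ tensorSymPow 𝕜 V i) {q : ℕ}
    (hq : tensorMap f (g.sum fun _ => id) ∈ tensorSymPow 𝕜 W q) :
    tensorMap f (g q) = tensorMap f (g.sum fun _ => id) :=
  map_component_eq (tensorMapₗ f) (tensorMapₗ ((2 : 𝕜) • LinearMap.id))
    two_pow_succ_injective g
    (fun i => tensorMap_smul_id (tensorMap_mem_tensorSymPow f (hg i)) 2)
    (tensorMap_smul_id hq 2)

omit [FiniteDimensional 𝕜 V] in
-- The degree `q` component of `z` works: `δ₁` and the restrictions commute with scaling, so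
-- vanishing passes to components, and the other components do not contribute to the image under
-- `f`.
theorem exists_homogeneous_mem_vanishingCycles {s : Set ι} (f : V →ₗ[𝕜] W)
    {z : Sym 𝕜 V ⊗[𝕜] V} (hz : z ∈ vanishingCycles U s) {q : ℕ}
    (hq : tensorMap f z ∈ tensorSymPow 𝕜 W q) :
    ∃ z' ∈ vanishingCycles U s, z' ∈ tensorSymPow 𝕜 V q ∧ tensorMap f z' = tensorMap f z := by
  have hz' : z ∈ ⨆ q, tensorSymPow 𝕜 V q := by rw [iSup_tensorSymPow]; trivial
  obtain ⟨g, hg, hgz⟩ := (Submodule.mem_iSup_iff_exists_finsupp _ _).1 hz'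
  change (g.sum fun _ => id) = z at hgz
  subst hgz
  rw [mem_vanishingCycles] at hz
  refine ⟨g q, mem_vanishingCycles.2 ⟨?_, fun t ht => ?_⟩, hg q, tensorMap_component_eq f hg hq⟩
  · refine (map_component_eq ((delta₁ 𝕜 V).restrictScalars 𝕜)
      (symMap ((2 : 𝕜) • LinearMap.id)).toLinearMap two_pow_succ_injective g
      (fun i => symMap_smul_id (delta₁_mem_symPow (hg i)) 2) ?_).trans hz.1
    change symMap _ (delta₁ 𝕜 V _) = _ • delta₁ 𝕜 V _
    rw [hz.1, map_zero, smul_zero]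
  · refine (tensorMap_component_eq _ hg ?_).trans (hz.2 t ht)
    rw [hz.2 t ht]
    exact zero_mem _

end Local

/-! ### High degrees and the dimension count -/

section Global

variable [IsAlgClosed 𝕜] [CharZero 𝕜] [FiniteDimensional 𝕜 V] {K : Submodule 𝕜 (⋀[𝕜]^2 V)}
  {ι : Type*} {U : ι → Submodule 𝕜 (Module.Dual 𝕜 V)}

theorem eventually_vanishingCycles_le (hsep : ∀ t, IsSeparable K (U t))
    (hcover : ∀ a ∈ resonance K, a ≠ 0 → ∃ t, a ∈ U t) :
    ∃ q₀, ∀ q, q₀ ≤ q → ∀ x ∈ vanishingCycles U Set.univ, x ∈ tensorSymPow 𝕜 V q →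
      x ∈ LinearMap.range (delta₂On K) :=
  exists_forall_mem_of_support _ _ (fun _ hx => tensorMap_scale_mem_range 2 hx)
    fun _ ha => exists_smul_vanishingCycles_le hsep hcover ha

/-- The support criterion is applied on `V/(U s)^⊥`, to all cycles against the restrictions of
cycles vanishing on the other components; a preimage is then made homogeneous. -/
theorem eventually_exists_vanishingCycles [Fintype ι]
    (hdisj : ∀ s t, s ≠ t → ∀ a ≠ 0, a ∈ U s → a ∉ U t) (s : ι) :
    ∃ q₀, ∀ q, q₀ ≤ q → ∀ y ∈ cycles 𝕜 (V ⧸ (U s).dualCoannihilator) q,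
      ∃ z ∈ vanishingCycles U {t | t ≠ s}, z ∈ tensorSymPow 𝕜 V q ∧
        tensorMap (U s).dualCoannihilator.mkQ z = y := by
  have : RingHomSurjective (symMap (U s).dualCoannihilator.mkQ :
      Sym 𝕜 V →+* Sym 𝕜 (V ⧸ (U s).dualCoannihilator)) :=
    ⟨symMap_surjective (Submodule.mkQ_surjective _)⟩
  obtain ⟨q₀, h⟩ := exists_forall_mem_of_support (𝕜 := 𝕜)
    (LinearMap.ker (delta₁ 𝕜 (V ⧸ (U s).dualCoannihilator)))
    ((vanishingCycles U {t | t ≠ s}).map (tensorMap (U s).dualCoannihilator.mkQ))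
    (by
      rintro _ ⟨x, hx, rfl⟩
      exact ⟨_, tensorMap_scale_mem_vanishingCycles 2 hx, tensorMap_scale_comm _ _ _⟩)
    (fun b hb => by
      obtain ⟨r, hr, h⟩ := exists_smul_mem_map_vanishingCycles hdisj s hb
      refine ⟨r, hr, fun y hy => ?_⟩
      obtain ⟨z, hz, e⟩ := h y hy
      exact ⟨z, hz, e⟩)
  refine ⟨q₀, fun q hq y hy => ?_⟩
  obtain ⟨z, hz, rfl⟩ := h q hq y hy.1 hy.2
  exact exists_homogeneous_mem_vanishingCycles _ hz hy.2

omit [IsAlgClosed 𝕜] [CharZero 𝕜] [FiniteDimensional 𝕜 V] in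
-- As in the Chinese remainder theorem, add up lifts that are each nonzero on at most one component.
theorem exists_forall_cyclesMap_eq [Fintype ι] {q : ℕ}
    (h : ∀ s, ∀ y ∈ cycles 𝕜 (V ⧸ (U s).dualCoannihilator) q,
      ∃ z ∈ vanishingCycles U {t | t ≠ s}, z ∈ tensorSymPow 𝕜 V q ∧
        tensorMap (U s).dualCoannihilator.mkQ z = y)
    (y : ∀ t, cycles 𝕜 (V ⧸ (U t).dualCoannihilator) q) :
    ∃ x, ∀ t, cyclesMap (U t).dualCoannihilator.mkQ q x = y t := by
  classical
  choose z hz hzq hzy using fun t => h t (y t) (y t).2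
  refine ⟨∑ t, ⟨z t, (mem_vanishingCycles.1 (hz t)).1, hzq t⟩, fun s => ?_⟩
  rw [map_sum, Finset.sum_eq_single s]
  · exact Subtype.ext (hzy s)
  · intro t _ hts
    exact Subtype.ext ((mem_vanishingCycles.1 (hz t)).2 s (Ne.symm hts))
  · exact fun h => absurd (Finset.mem_univ s) h

/-- The class in `W(V, K)` of a cycle. -/
noncomputable def cycleClass (K : Submodule 𝕜 (⋀[𝕜]^2 V)) (q : ℕ) :
    cycles 𝕜 V q →ₗ[𝕜] (Sym 𝕜 V ⊗[𝕜] V) ⧸ LinearMap.range (delta₂On K) :=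
  ((Submodule.mkQ (LinearMap.range (delta₂On K))).restrictScalars 𝕜).domRestrict _

omit [IsAlgClosed 𝕜] [CharZero 𝕜] [FiniteDimensional 𝕜 V] in
theorem range_cycleClass (q : ℕ) : LinearMap.range (cycleClass K (q + 1)) = koszulPiece K q :=
  LinearMap.range_domRestrict _ _

omit [IsAlgClosed 𝕜] [CharZero 𝕜] [FiniteDimensional 𝕜 V] in
theorem cycleClass_eq_zero_iff {q : ℕ} {x : cycles 𝕜 V q} : cycleClass K q x = 0 ↔
    (x : Sym 𝕜 V ⊗[𝕜] V) ∈ LinearMap.range (delta₂On K) :=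
  Submodule.Quotient.mk_eq_zero _

omit [IsAlgClosed 𝕜] [CharZero 𝕜] in
theorem range_delta₂On_le_ker_tensorMap {U : Submodule 𝕜 (Module.Dual 𝕜 V)}
    (h : IsIsotropic K U) :
    LinearMap.range (delta₂On K) ≤ LinearMap.ker (tensorMap U.dualCoannihilator.mkQ) :=
  range_delta₂On_le fun _ hκ => tensorMap_delta₂_of_isIsotropic h hκ

theorem finrank_koszulPiece [Fintype ι] (hsi : ∀ t, IsStronglyIsotropic K (U t))
    (hcover : ∀ a ∈ resonance K, a ≠ 0 → ∃ t, a ∈ U t)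
    (hdisj : ∀ s t, s ≠ t → ∀ a ≠ 0, a ∈ U s → a ∉ U t) :
    ∃ q₀, ∀ q, q₀ ≤ q → FiniteDimensional 𝕜 (koszulPiece K q) ∧
      Module.finrank 𝕜 (koszulPiece K q) =
        ∑ t, (q + 1) * (q + Module.finrank 𝕜 (U t)).choose (q + 2) := by
  obtain ⟨q₁, h₁⟩ := eventually_vanishingCycles_le (fun t => (hsi t).1) hcover
  choose q₂ h₂ using eventually_exists_vanishingCycles hdisj
  -- A common bound for all the thresholds. They are applied in degree `q + 1`, because `W_q`
  -- consists of classes from `V ⊗ Sym^{q+1} V`.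
  refine ⟨q₁ + ∑ t, q₂ t, fun q hq => ?_⟩
  have hq₁ : q₁ ≤ q + 1 := by omega
  have hq₂ : ∀ t, q₂ t ≤ q + 1 := fun t => by
    have := Finset.single_le_sum (fun i _ => Nat.zero_le (q₂ i)) (Finset.mem_univ t)
    omega
  -- Boundaries are exactly the cycles vanishing on all `U t`: isotropy gives one inclusion, the
  -- high degree the other.
  have hk : ∀ x : cycles 𝕜 V (q + 1), cycleClass K (q + 1) x = 0 ↔
      ∀ t, cyclesMap (U t).dualCoannihilator.mkQ (q + 1) x = 0 := fun x => by
    simp_rw [cycleClass_eq_zero_iff, cyclesMap_eq_zero_iff]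
    exact ⟨fun hx t => range_delta₂On_le_ker_tensorMap (hsi t).2 hx,
      fun hx => h₁ (q + 1) hq₁ x (mem_vanishingCycles.2 ⟨x.2.1, fun t _ => hx t⟩) x.2.2⟩
  have h := finrank_range_eq_sum (𝕜 := 𝕜) (A := cycles 𝕜 V (q + 1))
    (X := (Sym 𝕜 V ⊗[𝕜] V) ⧸ LinearMap.range (delta₂On K))
    (Y := fun t => cycles 𝕜 (V ⧸ (U t).dualCoannihilator) (q + 1)) (cycleClass K (q + 1))
    (fun t => cyclesMap (U t).dualCoannihilator.mkQ (q + 1)) hk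
    (exists_forall_cyclesMap_eq fun s => h₂ s (q + 1) (hq₂ s))
  simp_rw [finrank_cycles, finrank_quotient_dualCoannihilator] at h
  rw [← range_cycleClass]
  exact ⟨inferInstance, h⟩

end Global

end Main

end KoszulResonance

theorem corollary1p3 {𝕜 : Type*} [Field 𝕜] [IsAlgClosed 𝕜] [CharZero 𝕜]
    {V : Type*} [AddCommGroup V] [Module 𝕜 V] [FiniteDimensional 𝕜 V]
    (K : Submodule 𝕜 (⋀[𝕜]^2 V))
    (hK : KoszulResonance.StronglyIsotropicResonance K)
    (k : ℕ) (Vbar : Fin k → Submodule 𝕜 (Module.Dual 𝕜 V))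
    (hinj : Function.Injective Vbar)
    (hcomp : Set.range (fun t => (Vbar t : Set (Module.Dual 𝕜 V))) =
      KoszulResonance.resonanceComponents K) :
    ∃ q₀ : ℕ, ∀ q : ℕ, q₀ ≤ q →
      FiniteDimensional 𝕜 (KoszulResonance.koszulPiece K q) ∧
      Module.finrank 𝕜 (KoszulResonance.koszulPiece K q) =
        ∑ t : Fin k, (q + 1) * (q + Module.finrank 𝕜 (Vbar t)).choose (q + 2) := by
  have hsi : ∀ t, KoszulResonance.IsStronglyIsotropic K (Vbar t) := fun t => by
    obtain ⟨U, hU, h⟩ := hK _ (hcomp ▸ Set.mem_range_self t)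
    rwa [← SetLike.coe_injective hU]
  refine KoszulResonance.finrank_koszulPiece hsi (fun a ha _ => ?_) fun s t hst a ha hs ht => ?_
  · obtain ⟨Z, hZ, haZ⟩ := KoszulResonance.exists_resonanceComponent ha
    rw [← hcomp] at hZ
    obtain ⟨t, rfl⟩ := hZ
    exact ⟨t, haZ⟩
  -- Two components sharing the nonzero vector `a` contain each other, by separability of one and
  -- isotropy of the other.
  · exact hst (hinj (le_antisymm ((hsi t).1.mem_of_isIsotropic (hsi s).2 ha ht hs)
      ((hsi s).1.mem_of_isIsotropic (hsi t).2 ha hs ht)))
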